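/- A zonotope with zone vectors $V=\{v_1,\dots,v_m\}$ is, up to translation, the Minkowski sum $Z(V)=\sum_{i}[0,v_i]$. Let $V(n)=\{e_i-e_j : 1\le i<j\le n+1\}\subset\mathbb{R}^{n+1}$ be the set of zone vectors of the $n$-dimensional permutahedron $\Pi_n$, where $e_1,\dots,e_{n+1}$ is the standard basis. A $\Pi$-zonotope is a zonotope whose set of zone vectors is a subset of $V(n)$ for some $n$. For a centrally symmetric polytope $P$, the belt of a face $C$ of codimension $2$ is the set of all facets of $P$ parallel to $C$. The Venkov graph of $P$ has as vertices the pairs of opposite facets of $P$; two different pairs are joined by an edge if and only if some belt contains both of them. The belt diameter of $P$ is the diameter of its Venkov graph. Two sets $V_1,V_2$ of $d-1$ vectors each in a $d$-dimensional space are conjugate if each of them spans a $(d-1)$-dimensional space and, for all $u\in V_1$ and $w\in V_2$, both $\{u\}\cup V_2$ and $\{w\}\cup V_1$ span a $d$-dimensional space. A $d$-dimensional zonotope $Z(V)$ is symmetric if $V=V_1\cup V_2$ for two conjugate sets $V_1,V_2$. **Theorem.** Let $Z$ be a $d$-dimensional $\Pi$-zonotope with $d\ge 3$. If $3\le d\le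 6$, the belt diameter of $Z$ is at most $2$; if $d\ge 7$, it is at most $3$. Both bounds are attained in every dimension: for every $d$ with $3\le d\le 6$ (respectively every $d\ge 7$) there is a $d$-dimensional $\Pi$-zonotope with zone vectors in $V(d)$ whose belt diameter is exactly $2$ (respectively exactly $3$). Moreover, for $d=8$, the $\Pi$-zonotope in $\mathbb{R}^9$ whose zone vectors are the thirteen vectors $e_i-e_j$ with $$(i,j)\in\{(1,2),(2,3),(3,4),(4,5),(6,9),(8,9),(7,8),(3,6),(5,6),(5,8),(4,7),(2,7),(1,9)\}$$ is $8$-dimensional, is not symmetric, and has belt diameter $3$. -/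

import Mathlib

open scoped Pointwise

noncomputable section

namespace PiZonotope

section Polytopes

variable {E : Type*} [NormedAddCommGroup E] [NormedSpace ℝ E]

/-- The dimension of a set: the dimension of its affine hull. -/
def dim (P : Set E) : ℕ :=
  Module.finrank ℝ (vectorSpan ℝ P)

/-- `F` is a face of codimension `k` of the polytope `P`: a nonempty set cut out of `P` by a
supporting hyperplane (or `P` itself), of dimension `dim P - k`. -/
def IsFaceOfCodim (P : Set E) (k : ℕ) (F : Set E) : Prop :=
  F.Nonempty ∧ IsExposed ℝ P F ∧ dim F + k = dim P

/-- Facets are the faces of codimension one. -/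
def IsFacet (P F : Set E) : Prop :=
  IsFaceOfCodim P 1 F

/-- The set of all facets of `P` parallel to `C`; it is a belt of `P` when `C` is a face of
codimension two. -/
def belt (P C : Set E) : Set (Set E) :=
  {F | IsFacet P F ∧ vectorSpan ℝ C ≤ vectorSpan ℝ F}

/-- The pairs `{F, F'}` of opposite facets of a centrally symmetric polytope `P`: the facets `F` and
`F'` are exchanged by the central symmetry of `P` (the reflection in its centre `c`). -/
def oppositeFacetPairs (P : Set E) : Set (Set (Set E)) :=
  {p | ∃ (F : Set E) (c : E), IsFacet P F ∧ Equiv.pointReflection c '' P = P ∧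
    p = {F, Equiv.pointReflection c '' F}}

/-- The Venkov graph of `P`: the vertices are the pairs of opposite facets, and two different pairs
are joined by an edge if and only if some belt of `P` contains both pairs. -/
def venkovGraph (P : Set E) : SimpleGraph (oppositeFacetPairs P) where
  Adj p q := p ≠ q ∧ ∃ C : Set E, IsFaceOfCodim P 2 C ∧ p.1 ⊆ belt P C ∧ q.1 ⊆ belt P C
  symm := ⟨fun _ _ h => ⟨h.1.symm, by
    obtain ⟨C, hC, hp, hq⟩ := h.2
    exact ⟨C, hC, hq, hp⟩⟩⟩
  loopless := ⟨fun _ h => h.1 rfl⟩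

/-- The belt diameter of `P`, the diameter of its Venkov graph (`⊤` if that is disconnected). -/
def beltDiameter (P : Set E) : ℕ∞ :=
  (venkovGraph P).ediam

/-- The zonotope `Z(V)`: the Minkowski sum of the segments `[0, v]` over the zone vectors `v`. -/
def zonotope (V : Finset E) : Set E :=
  ∑ v ∈ V, segment ℝ 0 v

/-- `V₁` and `V₂` are conjugate vector sets in a `d`-dimensional space: each consists of `d - 1`
linearly independent vectors, and adding to one of them any vector of the other one gives a
`d`-dimensional set. -/
def IsConjugate (d : ℕ) (V₁ V₂ : Finset E) : Prop :=
  V₁.card + 1 = d ∧ V₂.card + 1 = d ∧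
  Module.finrank ℝ (Submodule.span ℝ ((V₁ : Set E) ∪ (V₂ : Set E))) = d ∧
  Module.finrank ℝ (Submodule.span ℝ (V₁ : Set E)) + 1 = d ∧
  Module.finrank ℝ (Submodule.span ℝ (V₂ : Set E)) + 1 = d ∧
  ∀ e₁ ∈ V₁, ∀ e₂ ∈ V₂,
    Module.finrank ℝ (Submodule.span ℝ (insert e₁ (V₂ : Set E))) = d ∧
    Module.finrank ℝ (Submodule.span ℝ (insert e₂ (V₁ : Set E))) = d

/-- `V` is the set of zone vectors of a `d`-dimensional symmetric zonotope: the union of two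
conjugate sets. -/
def IsSymmetricZoneSet (d : ℕ) (V : Finset E) : Prop :=
  ∃ V₁ V₂ : Finset E, IsConjugate d V₁ V₂ ∧ (V : Set E) = (V₁ : Set E) ∪ (V₂ : Set E)

end Polytopes

/-- The vector `e_i - e_j` of `ℝⁿ⁺¹`. -/
def zoneVector {n : ℕ} (i j : Fin (n + 1)) : EuclideanSpace ℝ (Fin (n + 1)) :=
  EuclideanSpace.single i 1 - EuclideanSpace.single j 1

/-- The set `V(n)` of zone vectors of the permutahedron `Π_n` in `ℝⁿ⁺¹`. -/
def permutahedronZoneVectors (n : ℕ) : Set (EuclideanSpace ℝ (Fin (n + 1))) :=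
  {v | ∃ i j : Fin (n + 1), i < j ∧ v = zoneVector i j}

/-- `P` is a Π-zonotope in `ℝⁿ⁺¹`: up to translation, a zonotope `Z(V)` with `V ⊆ V(n)`. (Replacing
a zone vector by its opposite only translates the zonotope.) -/
def IsPiZonotope (n : ℕ) (P : Set (EuclideanSpace ℝ (Fin (n + 1)))) : Prop :=
  ∃ (V : Finset (EuclideanSpace ℝ (Fin (n + 1)))) (t : EuclideanSpace ℝ (Fin (n + 1))),
    (V : Set (EuclideanSpace ℝ (Fin (n + 1)))) ⊆ permutahedronZoneVectors n ∧
    P = t +ᵥ zonotope V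

/-- The edges of a graph with the nine vertices `A₁, …, A₅ = 0, …, 4` and `B₁, …, B₄ = 5, …, 8`:
the paths `A₁A₂A₃A₄A₅` and `B₁B₄B₃B₂`, the path `A₃B₁A₅B₃`, and the edges `A₄B₂`, `A₂B₂`, `A₁B₄`. -/
def exampleEdges : Finset (Fin 9 × Fin 9) :=
  {(0, 1), (1, 2), (2, 3), (3, 4), (5, 8), (7, 8), (6, 7),
   (2, 5), (4, 5), (4, 7), (3, 6), (1, 6), (0, 8)}

open Classical in
/-- The zone vectors `e_i - e_j` belonging to the edges of that graph. -/
def exampleZoneVectors : Finset (EuclideanSpace ℝ (Fin (8 + 1))) :=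
  exampleEdges.image fun p => zoneVector (n := 8) p.1 p.2

end PiZonotope

end

/-! The face of `Z(V)` on which a functional `l` is maximal is a translate of the zonotope of the
zone vectors killed by `l`. So the Venkov graph is a matroid object: a pair of opposite facets is a
functional on `V`, up to scalars, whose zeros have corank one, and two such pairs lie in a common
belt when the common zeros have corank two. For a Π-zonotope the zone vectors are edges of a graph,
functionals are functions on its vertices, and facet pairs are the cuts whose two sides are both
connected.

Upper bound (`exists_path_of_cuts`). Given two cuts `A` and `B`, contract all edges crossing neither
of them; this does not affect being a facet or being close. Afterwards every edge crosses `A` or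
`B`. If the cuts are nested up to complements, they are close or share a one-vertex neighbour.
Otherwise all four pieces are nonempty. Removing from a side of `A` a non-cut vertex `r` of that
side shows that the cuts `A` and `{r}` are close. Each side of a cut has at least two such vertices,
so each cut has at least four; with at most seven vertices some `r` serves both `A` and `B`, which
gives distance two. In general, non-cut vertices `l` of `A` and `m` of `B` give the path `A`, `{l}`,
`{m}`, `B`, unless some vertex outside `A` and `B` has only `l` and `m` as neighbours, and then that
vertex serves both cuts. A connected graph of rank at most six has at most seven vertices.

Lower bound. Adjacent pairs share at least `d - 2` zone vectors. For the cycle, two disjoint cuts of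
two edges leave only `d - 3` common edges. For distance three (`three_le_beltDiameter`), take cuts
each leaving at most `d - 1` edges uncrossed: a common neighbour would be a nonconstant function on
the vertices that changes along at most one uncrossed edge of each cut. For a suitable cubic graph
on eight vertices, and for subdivisions of one, a finite check of two-colourings excludes this. -/

noncomputable section

namespace PiZonotope

/-! ### Faces, facet pairs and belts of a zonotope in terms of functionals -/

section Faces

variable {E : Type*} [NormedAddCommGroup E] [NormedSpace ℝ E]

lemma mem_zonotope {V : Finset E} {x : E} :
    x ∈ zonotope V ↔ ∃ c : E → ℝ, (∀ v ∈ V, 0 ≤ c v ∧ c v ≤ 1) ∧ ∑ v ∈ V, c v • v = x := by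
  classical
  rw [zonotope, Set.mem_finsetSum]
  constructor
  · rintro ⟨g, hg, rfl⟩
    have h : ∀ v, ∃ c : ℝ, v ∈ V → (0 ≤ c ∧ c ≤ 1) ∧ c • v = g v := by
      intro v
      by_cases hv : v ∈ V
      · have := hg hv
        rw [segment_eq_image] at this
        obtain ⟨c, hc, h⟩ := this
        exact ⟨c, fun _ => ⟨hc, by simpa using h⟩⟩
      · exact ⟨0, fun h => absurd h hv⟩
    choose c hc using h
    exact ⟨c, fun v hv => (hc v hv).1, Finset.sum_congr rfl fun v hv => (hc v hv).2⟩
  · rintro ⟨c, hc, rfl⟩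
    refine ⟨fun v => c v • v, fun {v} hv => ?_, rfl⟩
    rw [segment_eq_image]
    exact ⟨c v, hc v hv, by simp⟩

/-- The zone vectors on which a functional vanishes. -/
def zeros (V : Finset E) (l : E →L[ℝ] ℝ) : Finset E :=
  V.filter fun v => l v = 0

/-- The sum of the zone vectors on which a functional is positive. -/
def posSum (V : Finset E) (l : E →L[ℝ] ℝ) : E :=
  ∑ v ∈ V.filter fun v => 0 < l v, v

/-- The face of `P` on which the functional `l` is maximal. -/
def face (P : Set E) (l : E →L[ℝ] ℝ) : Set E :=
  {x | x ∈ P ∧ ∀ y ∈ P, l y ≤ l x}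

lemma mem_zeros {V : Finset E} {l : E →L[ℝ] ℝ} {v : E} : v ∈ zeros V l ↔ v ∈ V ∧ l v = 0 :=
  Finset.mem_filter

lemma zero_mem_zonotope (V : Finset E) : (0 : E) ∈ zonotope V :=
  mem_zonotope.2 ⟨0, by simp, by simp⟩

lemma vectorSpan_zonotope (V : Finset E) :
    vectorSpan ℝ (zonotope V) = Submodule.span ℝ (V : Set E) := by
  classical
  apply le_antisymm
  · rw [vectorSpan_def, Submodule.span_le]
    rintro _ ⟨x, hx, y, hy, rfl⟩
    obtain ⟨c, -, rfl⟩ := mem_zonotope.1 hx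
    obtain ⟨c', -, rfl⟩ := mem_zonotope.1 hy
    refine Submodule.sub_mem _ ?_ ?_ <;>
    exact Submodule.sum_mem _ fun v hv => Submodule.smul_mem _ _ (Submodule.subset_span hv)
  · rw [Submodule.span_le]
    intro v hv
    have h : v ∈ zonotope V := mem_zonotope.2
      ⟨fun w => if w = v then 1 else 0, fun w _ => by dsimp only; split_ifs <;> simp, by
        simp only [ite_smul, one_smul, zero_smul, Finset.sum_ite_eq']
        exact if_pos hv⟩
    simpa using vsub_mem_vectorSpan ℝ h (zero_mem_zonotope V)

lemma posSum_mem_zonotope (V : Finset E) (l : E →L[ℝ] ℝ) : posSum V l ∈ zonotope V :=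
  mem_zonotope.2 ⟨fun v => if 0 < l v then 1 else 0,
    fun v _ => by dsimp only; split_ifs <;> simp, by simp [posSum, Finset.sum_filter]⟩

lemma map_posSum (V : Finset E) (l : E →L[ℝ] ℝ) : l (posSum V l) = ∑ v ∈ V, max (l v) 0 := by
  rw [posSum, map_sum, Finset.sum_filter]
  refine Finset.sum_congr rfl fun v _ => ?_
  split_ifs with h
  · rw [max_eq_left h.le]
  · rw [max_eq_right (not_lt.1 h)]

lemma coeff_mul_le_max {c a : ℝ} (hc : 0 ≤ c ∧ c ≤ 1) : c * a ≤ max a 0 := by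
  rcases le_total a 0 with h | h
  · rw [max_eq_right h]; exact mul_nonpos_of_nonneg_of_nonpos hc.1 h
  · rw [max_eq_left h]; exact mul_le_of_le_one_left h hc.2

/-- To maximise `l` over sums `∑ c v • v` with coefficients in `[0, 1]`, the coefficient is forced
to be `1` where `l` is positive and `0` where it is negative, and stays free where `l` vanishes. -/
lemma face_zonotope (V : Finset E) (l : E →L[ℝ] ℝ) :
    face (zonotope V) l = posSum V l +ᵥ zonotope (zeros V l) := by
  classical
  ext x
  rw [Set.mem_vadd_set]
  constructor
  · rintro ⟨hx, hmax⟩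
    have h1 := hmax _ (posSum_mem_zonotope V l)
    obtain ⟨c, hc, rfl⟩ := mem_zonotope.1 hx
    rw [map_posSum, map_sum] at h1
    have hle : ∀ v ∈ V, l (c v • v) ≤ max (l v) 0 := fun v hv => by
      rw [map_smul, smul_eq_mul]; exact coeff_mul_le_max (hc v hv)
    -- A maximiser attains equality in a sum of termwise inequalities, hence in every term.
    have heq := (Finset.sum_eq_sum_iff_of_le hle).1 (le_antisymm (Finset.sum_le_sum hle) h1)
    refine ⟨∑ v ∈ zeros V l, c v • v, mem_zonotope.2
      ⟨c, fun v hv => hc v (mem_zeros.1 hv).1, rfl⟩, ?_⟩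
    rw [vadd_eq_add, posSum, zeros, Finset.sum_filter, Finset.sum_filter,
      ← Finset.sum_add_distrib]
    refine Finset.sum_congr rfl fun v hv => ?_
    have := heq v hv
    rw [map_smul, smul_eq_mul] at this
    rcases lt_trichotomy (l v) 0 with h | h | h
    · rw [max_eq_right h.le] at this
      have hc0 : c v = 0 := by
        rcases mul_eq_zero.1 this with h' | h'
        · exact h'
        · exact absurd h' h.ne
      simp [h.not_gt, h.ne, hc0]
    · simp [h]
    · rw [max_eq_left h.le] at this
      have hc0 : c v = 1 := mul_right_cancel₀ h.ne' (by rw [this, one_mul])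
      simp [h, h.ne', hc0]
  · rintro ⟨y, hy, rfl⟩
    obtain ⟨c, hc, rfl⟩ := mem_zonotope.1 hy
    have hz : l (∑ v ∈ zeros V l, c v • v) = 0 := by
      rw [map_sum]
      refine Finset.sum_eq_zero fun v hv => ?_
      rw [map_smul, (mem_zeros.1 hv).2, smul_zero]
    refine ⟨mem_zonotope.2 ⟨fun v => if 0 < l v then 1 else if l v = 0 then c v else 0,
      fun v hv => ?_, ?_⟩, fun y hy => ?_⟩
    · dsimp only
      split_ifs with h1 h2
      · simp
      · exact hc v (mem_zeros.2 ⟨hv, h2⟩)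
      · simp
    · rw [vadd_eq_add, posSum, zeros, Finset.sum_filter, Finset.sum_filter,
        ← Finset.sum_add_distrib]
      refine Finset.sum_congr rfl fun v _ => ?_
      by_cases h : 0 < l v
      · simp [h, h.ne']
      · by_cases h' : l v = 0 <;> simp [h, h']
    · rw [vadd_eq_add, map_add, hz, add_zero, map_posSum]
      obtain ⟨c', hc', rfl⟩ := mem_zonotope.1 hy
      rw [map_sum]
      refine Finset.sum_le_sum fun v hv => ?_
      rw [map_smul, smul_eq_mul]
      exact coeff_mul_le_max (hc' v hv)

lemma face_vadd (P : Set E) (t : E) (l : E →L[ℝ] ℝ) : face (t +ᵥ P) l = t +ᵥ face P l := by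
  ext x
  simp only [face, Set.mem_vadd_set, Set.mem_ofPred_eq]
  constructor
  · rintro ⟨⟨y, hy, rfl⟩, h⟩
    refine ⟨y, ⟨hy, fun z hz => ?_⟩, rfl⟩
    simpa using h _ ⟨z, hz, rfl⟩
  · rintro ⟨y, ⟨hy, h⟩, rfl⟩
    refine ⟨⟨y, hy, rfl⟩, ?_⟩
    rintro _ ⟨z, hz, rfl⟩
    simpa using h z hz

variable (V : Finset E) (t : E)

lemma vectorSpan_face (l : E →L[ℝ] ℝ) :
    vectorSpan ℝ (face (t +ᵥ zonotope V) l) = Submodule.span ℝ (zeros V l : Set E) := by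
  rw [face_vadd, face_zonotope, vectorSpan_vadd, vectorSpan_vadd, vectorSpan_zonotope]

lemma dim_vadd_zonotope :
    dim (t +ᵥ zonotope V) = Module.finrank ℝ (Submodule.span ℝ (V : Set E)) := by
  rw [dim, vectorSpan_vadd, vectorSpan_zonotope]

lemma face_nonempty (l : E →L[ℝ] ℝ) : (face (t +ᵥ zonotope V) l).Nonempty := by
  rw [face_vadd, face_zonotope]
  exact ((Set.nonempty_of_mem (zero_mem_zonotope _)).vadd_set).vadd_set

lemma isFaceOfCodim_iff (k : ℕ) (F : Set E) :
    IsFaceOfCodim (t +ᵥ zonotope V) k F ↔ ∃ l : E →L[ℝ] ℝ, F = face (t +ᵥ zonotope V) l ∧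
      Module.finrank ℝ (Submodule.span ℝ (zeros V l : Set E)) + k =
        Module.finrank ℝ (Submodule.span ℝ (V : Set E)) := by
  constructor
  · rintro ⟨hne, hexp, hdim⟩
    obtain ⟨l, rfl⟩ := hexp hne
    refine ⟨l, rfl, ?_⟩
    rw [← vectorSpan_face V t, ← dim_vadd_zonotope V t]
    exact hdim
  · rintro ⟨l, rfl, h⟩
    refine ⟨face_nonempty V t l, fun _ => ⟨l, rfl⟩, ?_⟩
    rw [dim_vadd_zonotope, dim, vectorSpan_face]
    exact h

lemma pointReflection_image_face {P : Set E} {c : E} (h : Equiv.pointReflection c '' P = P)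
    (l : E →L[ℝ] ℝ) : Equiv.pointReflection c '' face P l = face P (-l) := by
  have hm : ∀ x ∈ P, Equiv.pointReflection c x ∈ P := fun x hx => h ▸ Set.mem_image_of_mem _ hx
  have hl : ∀ x, l (Equiv.pointReflection c x) = 2 * l c - l x := fun x => by
    simp [Equiv.pointReflection_apply]; ring
  ext x
  constructor
  · rintro ⟨y, ⟨hy, hmax⟩, rfl⟩
    refine ⟨hm y hy, fun z hz => ?_⟩
    have := hmax _ (hm z hz)
    rw [hl] at this
    simp only [neg_apply, hl]
    linarith
  · rintro ⟨hx, hmax⟩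
    refine ⟨Equiv.pointReflection c x, ⟨hm x hx, fun z hz => ?_⟩,
      Equiv.pointReflection_involutive c x⟩
    have := hmax _ (hm z hz)
    simp only [neg_apply, hl] at this ⊢
    linarith

lemma exists_center : ∃ c, Equiv.pointReflection c '' (t +ᵥ zonotope V) = t +ᵥ zonotope V := by
  -- Reflection in this point replaces each coefficient `a v` by `1 - a v`.
  refine ⟨t + (1 / 2 : ℝ) • ∑ v ∈ V, v, ?_⟩
  set c := t + (1 / 2 : ℝ) • ∑ v ∈ V, v with hc
  have hm : ∀ x ∈ t +ᵥ zonotope V, Equiv.pointReflection c x ∈ t +ᵥ zonotope V := by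
    rintro _ ⟨x, hx, rfl⟩
    obtain ⟨a, ha, rfl⟩ := mem_zonotope.1 hx
    refine ⟨∑ v ∈ V, (1 - a v) • v, mem_zonotope.2 ⟨fun v => 1 - a v, fun v hv => ?_, rfl⟩, ?_⟩
    · have := ha v hv
      constructor <;> linarith
    · simp only [Equiv.pointReflection_apply, vadd_eq_add, vsub_eq_sub, sub_smul, one_smul,
        Finset.sum_sub_distrib, hc]
      module
  apply Set.Subset.antisymm
  · rintro _ ⟨x, hx, rfl⟩
    exact hm x hx
  · intro x hx
    exact ⟨_, hm x hx, Equiv.pointReflection_involutive c x⟩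

lemma mem_oppositeFacetPairs_iff (p : Set (Set E)) :
    p ∈ oppositeFacetPairs (t +ᵥ zonotope V) ↔ ∃ l : E →L[ℝ] ℝ,
      p = {face (t +ᵥ zonotope V) l, face (t +ᵥ zonotope V) (-l)} ∧
      Module.finrank ℝ (Submodule.span ℝ (zeros V l : Set E)) + 1 =
        Module.finrank ℝ (Submodule.span ℝ (V : Set E)) := by
  constructor
  · rintro ⟨F, c, hF, hc, rfl⟩
    obtain ⟨l, rfl, h⟩ := (isFaceOfCodim_iff V t 1 F).1 hF
    exact ⟨l, by rw [pointReflection_image_face hc], h⟩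
  · rintro ⟨l, rfl, h⟩
    obtain ⟨c, hc⟩ := exists_center V t
    exact ⟨_, c, (isFaceOfCodim_iff V t 1 _).2 ⟨l, rfl, h⟩, hc,
      by rw [pointReflection_image_face hc]⟩

lemma zeros_neg (l : E →L[ℝ] ℝ) : zeros V (-l) = zeros V l := by
  ext v; simp [mem_zeros]

lemma pair_subset_belt_iff {l : E →L[ℝ] ℝ}
    (hl : Module.finrank ℝ (Submodule.span ℝ (zeros V l : Set E)) + 1 =
        Module.finrank ℝ (Submodule.span ℝ (V : Set E))) (C : Set E) :
    {face (t +ᵥ zonotope V) l, face (t +ᵥ zonotope V) (-l)} ⊆ belt (t +ᵥ zonotope V) C ↔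
      vectorSpan ℝ C ≤ Submodule.span ℝ (zeros V l : Set E) := by
  rw [Set.insert_subset_iff, Set.singleton_subset_iff]
  constructor
  · rintro ⟨⟨-, h⟩, -⟩
    rwa [vectorSpan_face] at h
  · intro h
    refine ⟨⟨(isFaceOfCodim_iff V t 1 _).2 ⟨l, rfl, hl⟩, by rwa [vectorSpan_face]⟩,
      ⟨(isFaceOfCodim_iff V t 1 _).2 ⟨-l, rfl, by rwa [zeros_neg]⟩, by
        rwa [vectorSpan_face, zeros_neg]⟩⟩

end Faces

/-! ### Facets and adjacency for an abstract space of functions on the zone vectors -/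

section FacetFunctions

variable {ι : Type*}

/-- The zeros of `φ ∈ D` determine `φ` within `D` up to a scalar. -/
def IsFacetFn (D : Submodule ℝ (ι → ℝ)) (φ : ι → ℝ) : Prop :=
  φ ∈ D ∧ φ ≠ 0 ∧ ∀ ψ ∈ D, (∀ e, φ e = 0 → ψ e = 0) → ∃ c : ℝ, ψ = c • φ

/-- The common zeros of `φ` and `ψ` determine the span of `φ` and `ψ` within `D`. -/
def CloseFn (D : Submodule ℝ (ι → ℝ)) (φ ψ : ι → ℝ) : Prop :=
  ∀ χ ∈ D, (∀ e, φ e = 0 → ψ e = 0 → χ e = 0) → ∃ a b : ℝ, χ = a • φ + b • ψ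

end FacetFunctions

/-! ### Translation between distances in the Venkov graph and functionals -/

section Functionals

variable {E : Type*} [NormedAddCommGroup E] [NormedSpace ℝ E]

/-- The values of a functional on the zone vectors. -/
def restrict (V : Finset E) : (E →L[ℝ] ℝ) →ₗ[ℝ] (V → ℝ) where
  toFun l v := l v
  map_add' _ _ := rfl
  map_smul' _ _ := rfl

/-- The functions on `V` that come from functionals. -/
def functionals (V : Finset E) : Submodule ℝ (V → ℝ) :=
  LinearMap.range (restrict V)

lemma restrict_mem (V : Finset E) (l : E →L[ℝ] ℝ) : restrict V l ∈ functionals V :=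
  LinearMap.mem_range_self _ l

@[simp] lemma restrict_apply (V : Finset E) (l : E →L[ℝ] ℝ) (v : V) : restrict V l v = l v := rfl

lemma finrank_span_inf_ker {U : Submodule ℝ E} [FiniteDimensional ℝ U] {l : E →L[ℝ] ℝ}
    (h : ∃ x ∈ U, l x ≠ 0) :
    Module.finrank ℝ (U ⊓ LinearMap.ker (l : E →ₗ[ℝ] ℝ) : Submodule ℝ E) + 1 =
      Module.finrank ℝ U := by
  have hne : (l : E →ₗ[ℝ] ℝ).domRestrict U ≠ 0 := by
    obtain ⟨x, hx, hlx⟩ := h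
    intro h0
    exact hlx (by simpa using LinearMap.congr_fun h0 ⟨x, hx⟩)
  rw [← Module.Dual.finrank_ker_add_one_of_ne_zero hne,
    ← Submodule.finrank_map_subtype_eq U (LinearMap.ker _)]
  have : U ⊓ LinearMap.ker (l : E →ₗ[ℝ] ℝ) =
      Submodule.map U.subtype (LinearMap.ker ((l : E →ₗ[ℝ] ℝ).domRestrict U)) := by
    ext x
    simp [and_comm]
  rw [this]

lemma mem_span_of_forall_functional [FiniteDimensional ℝ E] {S : Set E} {x : E}
    (h : ∀ k : E →L[ℝ] ℝ, (∀ v ∈ S, k v = 0) → k x = 0) : x ∈ Submodule.span ℝ S := by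
  by_contra hx
  obtain ⟨f, hf, hle⟩ := Submodule.exists_le_ker_of_notMem hx
  exact hf (h (LinearMap.toContinuousLinearMap f) fun v hv => hle (Submodule.subset_span hv))

lemma eq_zero_of_mem_span {S : Set E} {k : E →L[ℝ] ℝ} (h : ∀ v ∈ S, k v = 0) {x : E}
    (hx : x ∈ Submodule.span ℝ S) : k x = 0 := by
  have : Submodule.span ℝ S ≤ LinearMap.ker (k : E →ₗ[ℝ] ℝ) := Submodule.span_le.2 h
  exact this hx

lemma span_zeros_le (V : Finset E) (l : E →L[ℝ] ℝ) :
    Submodule.span ℝ (zeros V l : Set E) ≤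
      Submodule.span ℝ (V : Set E) ⊓ LinearMap.ker (l : E →ₗ[ℝ] ℝ) :=
  le_inf (Submodule.span_mono fun _ hv => (mem_zeros.1 hv).1)
    (Submodule.span_le.2 fun _ hv => (mem_zeros.1 hv).2)

/-- Some functional vanishes exactly at the common zone vectors of `l` and `m`. -/
lemma exists_zeros_eq_inter (V : Finset E) (l m : E →L[ℝ] ℝ) :
    ∃ k : E →L[ℝ] ℝ, ∀ v ∈ V, k v = 0 ↔ l v = 0 ∧ m v = 0 := by
  classical
  -- Each `v` with `m v ≠ 0` rules out a single `ε`; vectors with `m v = 0` only add the harmless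
  -- exclusion `ε ≠ 0`.
  obtain ⟨ε, hε⟩ := Infinite.exists_notMem_finset (V.image fun v => -l v / m v)
  refine ⟨l + ε • m, fun v hv => ⟨fun h => ?_, fun h => by simp [h.1, h.2]⟩⟩
  simp only [add_apply, smul_apply, smul_eq_mul] at h
  by_cases hm : m v = 0
  · rw [hm] at h
    exact ⟨by linarith, hm⟩
  · refine absurd (Finset.mem_image.2 ⟨v, hv, ?_⟩) hε
    rw [div_eq_iff hm]
    linarith

lemma face_congr {V : Finset E} {l m : E →L[ℝ] ℝ} (t : E)
    (hpos : ∀ v ∈ V, 0 < l v ↔ 0 < m v) (hzero : ∀ v ∈ V, l v = 0 ↔ m v = 0) :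
    face (t +ᵥ zonotope V) l = face (t +ᵥ zonotope V) m := by
  rw [face_vadd, face_vadd, face_zonotope, face_zonotope, posSum, posSum, zeros, zeros,
    Finset.filter_congr hpos, Finset.filter_congr hzero]

lemma zeros_subset_of_span_le {V : Finset E} {l : E →L[ℝ] ℝ} {k : E →L[ℝ] ℝ}
    (h : Submodule.span ℝ (zeros V k : Set E) ≤ Submodule.span ℝ (zeros V l : Set E)) :
    zeros V k ⊆ zeros V l := fun _ hv =>
  mem_zeros.2 ⟨(mem_zeros.1 hv).1, eq_zero_of_mem_span (fun _ hu => (mem_zeros.1 hu).2)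
    (h (Submodule.subset_span (Finset.mem_coe.2 hv)))⟩

variable [FiniteDimensional ℝ E] {V : Finset E} {l m : E →L[ℝ] ℝ}

/-- Both sides say that the zeros of `l` span the whole kernel of `l` inside the span of `V`: by
duality, when every functional killing the zeros is a multiple of `l` there. -/
lemma isFacetFn_iff_finrank : IsFacetFn (functionals V) (restrict V l) ↔
    Module.finrank ℝ (Submodule.span ℝ (zeros V l : Set E)) + 1 =
      Module.finrank ℝ (Submodule.span ℝ (V : Set E)) := by
  constructor
  · rintro ⟨-, hne, h⟩
    obtain ⟨v, hv⟩ := Function.ne_iff.1 hne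
    rw [← finrank_span_inf_ker (l := l) ⟨v, Submodule.subset_span v.2, hv⟩]
    refine congrArg (fun W : Submodule ℝ E => Module.finrank ℝ W + 1)
      (le_antisymm (span_zeros_le V l) fun x hx => ?_)
    refine mem_span_of_forall_functional fun k hk => ?_
    obtain ⟨c, hc⟩ := h _ (restrict_mem V k) fun v hv => hk v (mem_zeros.2 ⟨v.2, hv⟩)
    have : ∀ w ∈ (V : Set E), (k - c • l) w = 0 := fun w hw => by
      have := congrFun hc ⟨w, hw⟩
      simp at this ⊢
      linarith
    have h0 := eq_zero_of_mem_span this hx.1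
    have hlx : l x = 0 := hx.2
    simpa [hlx] using h0
  · intro h
    have hne : ∃ v ∈ V, l v ≠ 0 := by
      by_contra! h0
      have : zeros V l = V := Finset.filter_true_of_mem h0
      rw [this] at h
      omega
    obtain ⟨v, hv, hlv⟩ := hne
    refine ⟨restrict_mem V l, fun h0 => hlv (congrFun h0 ⟨v, hv⟩), ?_⟩
    have hv' := Submodule.subset_span (R := ℝ) (Finset.mem_coe.2 hv)
    have heq := Submodule.eq_of_le_of_finrank_eq (span_zeros_le V l)
      (by have := finrank_span_inf_ker (l := l) ⟨v, hv', hlv⟩; omega)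
    rintro _ ⟨k, rfl⟩ hk
    refine ⟨k v / l v, ?_⟩
    ext w
    -- Correcting `w` by a multiple of `v` moves it into the kernel of `l`, where `k` vanishes.
    have hw : (w : E) - (l w / l v) • v ∈ Submodule.span ℝ (zeros V l : Set E) := by
      rw [heq]
      refine ⟨Submodule.sub_mem _ (Submodule.subset_span w.2) (Submodule.smul_mem _ _ hv'), ?_⟩
      simp [hlv]
    have := eq_zero_of_mem_span (k := k)
      (fun u hu => hk ⟨u, (mem_zeros.1 hu).1⟩ (mem_zeros.1 hu).2) hw
    simp at this ⊢
    rw [sub_eq_zero] at this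
    rw [this]; ring

/-- Closeness makes the common zeros span the intersection of the two kernels, and independence of
`l` and `m` on `V` makes that intersection drop the dimension twice. -/
lemma finrank_span_zeros_of_closeFn (hl : IsFacetFn (functionals V) (restrict V l))
    (hlm : CloseFn (functionals V) (restrict V l) (restrict V m))
    (hne : ¬ ∃ c : ℝ, restrict V m = c • restrict V l) {k : E →L[ℝ] ℝ}
    (hk : ∀ v ∈ V, k v = 0 ↔ l v = 0 ∧ m v = 0) :
    Module.finrank ℝ (Submodule.span ℝ (zeros V k : Set E)) + 2 =
      Module.finrank ℝ (Submodule.span ℝ (V : Set E)) := by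
  obtain ⟨v, hv⟩ := Function.ne_iff.1 hl.2.1
  have h1 := finrank_span_inf_ker (l := l) ⟨v, Submodule.subset_span v.2, hv⟩
  have hx : ∃ w ∈ zeros V l, m w ≠ 0 := by
    by_contra! h0
    exact hne (hl.2.2 _ (restrict_mem V m) fun v hv => h0 v (mem_zeros.2 ⟨v.2, hv⟩))
  obtain ⟨w, hw, hmw⟩ := hx
  have h2 := finrank_span_inf_ker (l := m)
    ⟨w, span_zeros_le V l (Submodule.subset_span (Finset.mem_coe.2 hw)), hmw⟩
  rw [← h1, ← h2]
  have : Submodule.span ℝ (zeros V k : Set E) = Submodule.span ℝ (V : Set E) ⊓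
      LinearMap.ker (l : E →ₗ[ℝ] ℝ) ⊓ LinearMap.ker (m : E →ₗ[ℝ] ℝ) := by
    refine le_antisymm (Submodule.span_le.2 fun u hu => ?_) fun x hx => ?_
    · obtain ⟨huV, hku⟩ := mem_zeros.1 hu
      have := (hk u huV).1 hku
      exact ⟨⟨Submodule.subset_span huV, this.1⟩, this.2⟩
    · refine mem_span_of_forall_functional fun g hg => ?_
      obtain ⟨a, b, hab⟩ := hlm _ (restrict_mem V g) fun v hlv hmv =>
        hg v (mem_zeros.2 ⟨v.2, (hk v v.2).2 ⟨hlv, hmv⟩⟩)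
      have : ∀ u ∈ (V : Set E), (g - (a • l + b • m)) u = 0 := fun u hu => by
        have := congrFun hab ⟨u, hu⟩
        simp at this ⊢
        linarith
      have h0 := eq_zero_of_mem_span this hx.1.1
      have hlx : l x = 0 := hx.1.2
      have hmx : m x = 0 := hx.2
      simpa [hlx, hmx] using h0
  rw [this]

variable (t : E)

/-- The pair of opposite facets on which a functional is extremal. -/
def facetPair (V : Finset E) (t : E) (l : E →L[ℝ] ℝ)
    (hl : IsFacetFn (functionals V) (restrict V l)) : oppositeFacetPairs (t +ᵥ zonotope V) :=
  ⟨{face (t +ᵥ zonotope V) l, face (t +ᵥ zonotope V) (-l)},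
    (mem_oppositeFacetPairs_iff V t _).2 ⟨l, rfl, isFacetFn_iff_finrank.1 hl⟩⟩

lemma exists_eq_facetPair (p : oppositeFacetPairs (t +ᵥ zonotope V)) :
    ∃ l hl, p = facetPair V t l hl := by
  obtain ⟨p, hp⟩ := p
  obtain ⟨l, rfl, hl⟩ := (mem_oppositeFacetPairs_iff V t _).1 hp
  exact ⟨l, isFacetFn_iff_finrank.2 hl, rfl⟩

lemma facetPair_eq_of_eq_smul (hl : IsFacetFn (functionals V) (restrict V l))
    (hm : IsFacetFn (functionals V) (restrict V m)) {c : ℝ}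
    (hc : restrict V m = c • restrict V l) : facetPair V t l hl = facetPair V t m hm := by
  have hcv : ∀ v ∈ V, m v = c * l v := fun v hv => congrFun hc ⟨v, hv⟩
  have hc0 : c ≠ 0 := by
    rintro rfl
    exact hm.2.1 (by rw [hc, zero_smul])
  apply Subtype.ext
  change ({_, _} : Set (Set E)) = {_, _}
  rcases lt_or_gt_of_ne hc0 with h | h
  · rw [Set.pair_comm, face_congr t (l := -l) (m := m), face_congr t (l := l) (m := -m)]
    · intro v hv
      rw [neg_apply, hcv v hv, neg_pos, mul_neg_iff]
      exact ⟨fun h' => Or.inr ⟨h, h'⟩, fun h' => by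
        rcases h' with h' | h'
        · exact absurd h h'.1.not_gt
        · exact h'.2⟩
    · intro v hv
      simp [hcv v hv, hc0]
    · intro v hv
      rw [neg_apply, hcv v hv, mul_pos_iff, neg_pos]
      exact ⟨fun h' => Or.inr ⟨h, h'⟩, fun h' => by
        rcases h' with h' | h'
        · exact absurd h h'.1.not_gt
        · exact h'.2⟩
    · intro v hv
      simp [hcv v hv, hc0]
  · rw [face_congr t (l := l) (m := m), face_congr t (l := -l) (m := -m)]
    · intro v hv
      simp [hcv v hv, h, h.not_gt, mul_neg_iff]
    · intro v hv
      simp [hcv v hv, hc0]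
    · intro v hv
      simp [hcv v hv, h]
    · intro v hv
      simp [hcv v hv, hc0]

/-- The belt is that of the face of a functional vanishing exactly at the common zeros; proportional
functionals give the same pair. -/
lemma edist_facetPair_le_one (hl : IsFacetFn (functionals V) (restrict V l))
    (hm : IsFacetFn (functionals V) (restrict V m))
    (hlm : CloseFn (functionals V) (restrict V l) (restrict V m)) :
    (venkovGraph (t +ᵥ zonotope V)).edist (facetPair V t l hl) (facetPair V t m hm) ≤ 1 := by
  rw [SimpleGraph.edist_le_one_iff_adj_or_eq]
  by_cases hc : ∃ c : ℝ, restrict V m = c • restrict V l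
  · obtain ⟨c, hc⟩ := hc
    exact Or.inr (facetPair_eq_of_eq_smul t hl hm hc)
  · by_cases heq : facetPair V t l hl = facetPair V t m hm
    · exact Or.inr heq
    obtain ⟨k, hk⟩ := exists_zeros_eq_inter V l m
    have hsub : ∀ v ∈ zeros V k, v ∈ zeros V l ∧ v ∈ zeros V m := fun v hv => by
      obtain ⟨hV, hkv⟩ := mem_zeros.1 hv
      have := (hk v hV).1 hkv
      exact ⟨mem_zeros.2 ⟨hV, this.1⟩, mem_zeros.2 ⟨hV, this.2⟩⟩
    refine Or.inl ⟨heq, face (t +ᵥ zonotope V) k, (isFaceOfCodim_iff V t 2 _).2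
      ⟨k, rfl, finrank_span_zeros_of_closeFn hl hlm hc hk⟩, ?_, ?_⟩
    · refine (pair_subset_belt_iff V t (isFacetFn_iff_finrank.1 hl) _).2 ?_
      rw [vectorSpan_face]
      exact Submodule.span_mono fun v hv => (hsub v hv).1
    · refine (pair_subset_belt_iff V t (isFacetFn_iff_finrank.1 hm) _).2 ?_
      rw [vectorSpan_face]
      exact Submodule.span_mono fun v hv => (hsub v hv).2

/-- Pairs of facets at distance at most one have many common zone vectors. -/
lemma finrank_le_card_of_edist_le_one (hl : IsFacetFn (functionals V) (restrict V l))
    (hm : IsFacetFn (functionals V) (restrict V m))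
    (h : (venkovGraph (t +ᵥ zonotope V)).edist (facetPair V t l hl) (facetPair V t m hm) ≤ 1) :
    Module.finrank ℝ (Submodule.span ℝ (V : Set E)) ≤
      (V.filter fun v => l v = 0 ∧ m v = 0).card + 2 := by
  have key : ∀ k : E →L[ℝ] ℝ, ∀ j ≤ 2, zeros V k ⊆ zeros V l → zeros V k ⊆ zeros V m →
      Module.finrank ℝ (Submodule.span ℝ (zeros V k : Set E)) + j =
        Module.finrank ℝ (Submodule.span ℝ (V : Set E)) →
      Module.finrank ℝ (Submodule.span ℝ (V : Set E)) ≤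
        (V.filter fun v => l v = 0 ∧ m v = 0).card + 2 := by
    intro k j hj h1 h2 h3
    have h4 : Module.finrank ℝ (Submodule.span ℝ (zeros V k : Set E)) ≤ (zeros V k).card :=
      finrank_span_finset_le_card _
    have h5 : (zeros V k).card ≤ (V.filter fun v => l v = 0 ∧ m v = 0).card :=
      Finset.card_le_card fun v hv => Finset.mem_filter.2
        ⟨(mem_zeros.1 hv).1, (mem_zeros.1 (h1 hv)).2, (mem_zeros.1 (h2 hv)).2⟩
    omega
  rw [SimpleGraph.edist_le_one_iff_adj_or_eq] at h
  rcases h with ⟨-, C, hC, hlC, hmC⟩ | h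
  · obtain ⟨k, rfl, hk⟩ := (isFaceOfCodim_iff V t 2 _).1 hC
    have h1 := (pair_subset_belt_iff V t (isFacetFn_iff_finrank.1 hl) _).1 hlC
    have h2 := (pair_subset_belt_iff V t (isFacetFn_iff_finrank.1 hm) _).1 hmC
    rw [vectorSpan_face] at h1 h2
    exact key k 2 le_rfl (zeros_subset_of_span_le h1) (zeros_subset_of_span_le h2) hk
  · have h0 : face (t +ᵥ zonotope V) l ∈ (facetPair V t m hm).1 := by
      rw [← h]; exact Set.mem_insert _ _
    have h1 : Submodule.span ℝ (zeros V l : Set E) ≤ Submodule.span ℝ (zeros V m : Set E) := by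
      rw [← vectorSpan_face V t l]
      rcases h0 with h0 | h0
      · rw [h0, vectorSpan_face]
      · rw [h0, vectorSpan_face, zeros_neg]
    exact key l 1 one_le_two subset_rfl (zeros_subset_of_span_le h1)
      (isFacetFn_iff_finrank.1 hl)

end Functionals

/-! ### Connected sides of cuts and short paths between cuts -/

section Connected

variable {X : Type*} (G : SimpleGraph X)

/-- `A` induces a connected subgraph, in terms of functions. -/
def Conn (A : Set X) : Prop :=
  ∀ f : X → ℝ, (∀ x ∈ A, ∀ y ∈ A, G.Adj x y → f x = f y) → ∀ x ∈ A, ∀ y ∈ A, f x = f y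

/-- The functions that are constant on the edges which cross neither `A` nor `B` are the
combinations of the indicators of `A`, `B` and the whole vertex set. -/
def CloseCuts (A B : Set X) : Prop :=
  ∀ f : X → ℝ, (∀ x y, G.Adj x y → (x ∈ A ↔ y ∈ A) → (x ∈ B ↔ y ∈ B) → f x = f y) →
    ∃ a b c : ℝ, ∀ x, f x = a * A.indicator 1 x + b * B.indicator 1 x + c

variable {G} {A B S T W : Set X}

lemma Conn.exists_const (hA : Conn G A) {f : X → ℝ}
    (hf : ∀ x ∈ A, ∀ y ∈ A, G.Adj x y → f x = f y) : ∃ c, ∀ x ∈ A, f x = c := by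
  rcases A.eq_empty_or_nonempty with rfl | ⟨x, hx⟩
  · exact ⟨0, by simp⟩
  · exact ⟨f x, fun y hy => hA f hf y hy x hx⟩

lemma conn_singleton (x : X) : Conn G {x} := by
  rintro f - y rfl z rfl
  rfl

lemma Conn.union (hA : Conn G A) (hB : Conn G B) (h : (A ∩ B).Nonempty) : Conn G (A ∪ B) := by
  obtain ⟨w, hwA, hwB⟩ := h
  intro f hf
  have h : ∀ x ∈ A ∪ B, f x = f w := by
    rintro x (hx | hx)
    · exact hA f (fun x hx y hy => hf x (Or.inl hx) y (Or.inl hy)) x hx w hwA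
    · exact hB f (fun x hx y hy => hf x (Or.inr hx) y (Or.inr hy)) x hx w hwB
  intro x hx y hy
  rw [h x hx, h y hy]

lemma Conn.attach (hW : Conn G W) (hWT : W ⊆ T) (h : ∀ x ∈ T, x ∉ W → ∃ y ∈ W, G.Adj x y) :
    Conn G T := by
  intro f hf
  obtain ⟨c, hc⟩ := hW.exists_const fun x hx y hy => hf x (hWT hx) y (hWT hy)
  have h : ∀ x ∈ T, f x = c := by
    intro x hx
    by_cases hxW : x ∈ W
    · exact hc x hxW
    · obtain ⟨y, hy, hxy⟩ := h x hx hxW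
      rw [hf x hx y (hWT hy) hxy, hc y hy]
  intro x hx y hy
  rw [h x hx, h y hy]

lemma Conn.exists_adj (hS : Conn G S) {x y : X} (hx : x ∈ S) (hy : y ∈ S) (hxW : x ∈ W)
    (hyW : y ∉ W) : ∃ x ∈ S, ∃ y ∈ S, x ∈ W ∧ y ∉ W ∧ G.Adj x y := by
  classical
  by_contra! h
  have := hS (W.indicator 1) (fun u hu v hv huv => by
    by_cases h1 : u ∈ W <;> by_cases h2 : v ∈ W
    · simp [h1, h2]
    · exact absurd huv (h u hu v hv h1 h2)
    · exact absurd huv.symm (h v hv u hu h2 h1)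
    · simp [h1, h2]) x hx y hy
  simp [hxW, hyW] at this

lemma Conn.exists_adj_across (hS : Conn G S)
    (hin : ∀ x ∈ S, ∀ y ∈ S, G.Adj x y → ¬ (x ∈ T ↔ y ∈ T)) {x w : X} (hx : x ∈ S) (hw : w ∈ S)
    (hxw : ¬ (x ∈ T ↔ w ∈ T)) : ∃ z ∈ S, G.Adj x z ∧ ¬ (x ∈ T ↔ z ∈ T) := by
  have hne : w ∉ ({x} : Set X) := by rintro rfl; exact hxw Iff.rfl
  obtain ⟨_, -, z, hz, rfl, -, hadj⟩ := hS.exists_adj hx hw (Set.mem_singleton x) hne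
  exact ⟨z, hz, hadj, hin _ hx z hz hadj⟩

/-- Giving `v` the value at its only possible neighbour `m` extends any function constant along the
edges off `v`. -/
lemma Conn.diff_singleton_of_leaf (hS : Conn G S) {v m : X}
    (h : ∀ y ∈ S, G.Adj v y → y = m) : Conn G (S \ {v}) := by
  classical
  intro f hf
  have := hS (Function.update f v (f m)) fun x hx y hy hxy => by
    by_cases h1 : x = v
    · subst h1
      have hym := h y hy hxy
      rw [Function.update_self, Function.update_of_ne hxy.ne', hym]
    · by_cases h2 : y = v
      · subst h2
        have hxm := h x hx hxy.symm
        rw [Function.update_self, Function.update_of_ne h1, hxm]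
      · rw [Function.update_of_ne h1, Function.update_of_ne h2]
        exact hf x ⟨hx, h1⟩ y ⟨hy, h2⟩ hxy
  intro x hx y hy
  have hxy := this x hx.1 y hy.1
  rwa [Function.update_of_ne hx.2, Function.update_of_ne hy.2] at hxy

/-- A maximal connected proper subset containing `u` must become `S` on adding one adjacent vertex,
and that vertex can be removed. -/
lemma Conn.exists_noncut [Finite X] (hS : Conn G S) {u w : X} (hu : u ∈ S) (hw : w ∈ S)
    (huw : w ≠ u) : ∃ l ∈ S, l ≠ u ∧ Conn G (S \ {l}) := by
  obtain ⟨W, hW⟩ := Set.Finite.exists_maximal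
    (Set.toFinite {W : Set X | u ∈ W ∧ W ⊂ S ∧ Conn G W})
    ⟨{u}, rfl, ⟨Set.singleton_subset_iff.2 hu, fun h => huw (h hw)⟩, conn_singleton u⟩
  obtain ⟨⟨huW, hWS, hcW⟩, hmax⟩ := hW
  obtain ⟨y, hyS, hyW⟩ := Set.exists_of_ssubset hWS
  obtain ⟨x, -, z, hz, hxW, hzW, hadj⟩ := hS.exists_adj hu hyS huW hyW
  have hc : Conn G (insert z W) := hcW.attach (Set.subset_insert z W) (by
    rintro v (rfl | hv) hvW
    · exact ⟨x, hxW, hadj.symm⟩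
    · exact absurd hv hvW)
  have heq : insert z W = S := by
    by_contra hne
    exact hzW (hmax ⟨Set.mem_insert_of_mem z huW,
      (Set.insert_subset hz hWS.1).ssubset_of_ne hne, hc⟩ (Set.subset_insert z W)
      (Set.mem_insert z W))
  refine ⟨z, hz, fun h => hzW (h ▸ huW), ?_⟩
  rwa [← heq, Set.insert_sdiff_self_of_notMem hzW]

lemma CloseCuts.symm (h : CloseCuts G A B) : CloseCuts G B A := by
  intro f hf
  obtain ⟨a, b, c, habc⟩ := h f fun x y hxy hA hB => hf x y hxy hB hA
  exact ⟨b, a, c, fun x => by rw [habc]; ring⟩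

lemma CloseCuts.compl_left (h : CloseCuts G A B) : CloseCuts G Aᶜ B := by
  intro f hf
  obtain ⟨a, b, c, habc⟩ := h f fun x y hxy hA hB => hf x y hxy (not_congr hA) hB
  refine ⟨-a, b, c + a, fun x => ?_⟩
  rw [habc]
  by_cases h : x ∈ A <;> simp [h] <;> ring

lemma CloseCuts.of_compl_left (h : CloseCuts G Aᶜ B) : CloseCuts G A B := by
  simpa using h.compl_left

lemma CloseCuts.of_compl_right (h : CloseCuts G A Bᶜ) : CloseCuts G A B :=
  h.symm.of_compl_left.symm

/-- Nested cuts split the vertices into `Aᶜ`, `B` and `A \ B`; when these are connected, a function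
constant along the uncrossed edges takes one value on each. -/
lemma closeCuts_of_subset (hA : Conn G Aᶜ) (hB : Conn G B) (hBA : B ⊆ A) {S : Set X}
    (hS : Conn G S) (hAB : S = A \ B) : CloseCuts G A B := by
  subst hAB
  intro f hf
  obtain ⟨α, hα⟩ := hA.exists_const (f := f) fun x hx y hy hxy =>
    hf x y hxy (iff_of_false hx hy) (iff_of_false (fun h => hx (hBA h)) fun h => hy (hBA h))
  obtain ⟨β, hβ⟩ := hB.exists_const (f := f) fun x hx y hy hxy =>
    hf x y hxy (iff_of_true (hBA hx) (hBA hy)) (iff_of_true hx hy)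
  obtain ⟨γ, hγ⟩ := hS.exists_const (f := f) fun x hx y hy hxy =>
    hf x y hxy (iff_of_true hx.1 hy.1) (iff_of_false hx.2 hy.2)
  refine ⟨γ - α, β - γ, α, fun x => ?_⟩
  by_cases h1 : x ∈ A
  · by_cases h2 : x ∈ B
    · simp [h1, h2, hβ x h2]
    · simp [h1, h2, hγ x ⟨h1, h2⟩]
  · have h2 : x ∉ B := fun h => h1 (hBA h)
    simp [h1, h2, hα x h1]

lemma closeCuts_singleton (hA' : Conn G Aᶜ) {v : X} (hv : v ∈ A) (h : Conn G (A \ {v})) :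
    CloseCuts G A {v} :=
  closeCuts_of_subset hA' (conn_singleton v) (Set.singleton_subset_iff.2 hv) h rfl

lemma closeCuts_singleton_singleton {l m : X} (hlm : l ≠ m) (h : Conn G ({l, m} : Set X)ᶜ) :
    CloseCuts G {l} {m} := by
  refine CloseCuts.of_compl_left (closeCuts_of_subset (S := ({l, m} : Set X)ᶜ) ?_
    (conn_singleton m) ?_ h ?_)
  · rw [compl_compl]; exact conn_singleton l
  · rintro _ rfl; exact hlm.symm
  · ext x; simp [not_or]

lemma Conn.compl_of_subset (hB : Conn G Bᶜ) (h : ∀ x ∈ B, ∃ y ∈ Bᶜ, G.Adj x y) {M : Set X}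
    (hM : M ⊆ B) : Conn G Mᶜ :=
  hB.attach (Set.compl_subset_compl.2 hM) fun x _ hx => h x (not_not.1 hx)

/-- A vertex `r` such that the cuts `A`, `{r}` and `B` are consecutively close. -/
def IsMidVertex (G : SimpleGraph X) (A B : Set X) (r : X) : Prop :=
  Conn G ({r} : Set X)ᶜ ∧ CloseCuts G A {r} ∧ CloseCuts G {r} B

/-- Either the cuts are close, or they are both close to the cut of one vertex. -/
def AtMostTwo (G : SimpleGraph X) (A B : Set X) : Prop :=
  CloseCuts G A B ∨ ∃ r, IsMidVertex G A B r

lemma AtMostTwo.of_compl_left (h : AtMostTwo G Aᶜ B) : AtMostTwo G A B :=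
  h.imp CloseCuts.of_compl_left fun ⟨r, h1, h2, h3⟩ => ⟨r, h1, h2.of_compl_left, h3⟩

lemma AtMostTwo.of_compl_right (h : AtMostTwo G A Bᶜ) : AtMostTwo G A B :=
  h.imp CloseCuts.of_compl_right fun ⟨r, h1, h2, h3⟩ => ⟨r, h1, h2, h3.of_compl_right⟩

/-- No edge lies inside `A \ B`, so each of its vertices has a neighbour in `B` and one in `Aᶜ`. Any
single vertex of `A \ B` can therefore be removed without disconnecting `A` or `Bᶜ`. -/
lemma atMostTwo_of_subset (hA : Conn G A) (hA' : Conn G Aᶜ) (hB : Conn G B) (hB' : Conn G Bᶜ)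
    (hneA : Aᶜ.Nonempty) (hneB : B.Nonempty)
    (hin : ∀ x y, G.Adj x y → (x ∈ A ↔ y ∈ A) → ¬ (x ∈ B ↔ y ∈ B)) (h : B ⊆ A) :
    AtMostTwo G A B := by
  by_cases hQ : (A \ B).Subsingleton
  · refine Or.inl (closeCuts_of_subset hA' hB h (S := A \ B) ?_ rfl)
    intro f _ x hx y hy
    rw [hQ hx hy]
  · rw [Set.not_subsingleton_iff] at hQ
    obtain ⟨q, hq, q', hq', hne⟩ := hQ
    obtain ⟨p, hp⟩ := hneB
    obtain ⟨s, hs⟩ := hneA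
    have hsB : s ∉ B := fun h' => hs (h h')
    have h1 : Conn G (A \ {q}) := by
      refine hB.attach (fun x hx => ⟨h hx, ?_⟩) fun x hx hxB => ?_
      · rintro rfl; exact hq.2 hx
      · obtain ⟨z, -, hadj, hz⟩ := hA.exists_adj_across (T := B)
          (fun x hx y hy hxy => hin x y hxy (iff_of_true hx hy)) hx.1 (h hp)
          (by simp [hxB, hp])
        exact ⟨z, by tauto, hadj⟩
    have h2 : Conn G (Bᶜ \ {q}) := by
      refine hA'.attach (fun x hx => ⟨fun hxB => hx (h hxB), ?_⟩) fun x hx hxA => ?_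
      · rintro rfl; exact hx hq.1
      · rw [Set.mem_compl_iff, not_not] at hxA
        obtain ⟨z, -, hadj, hz⟩ := hB'.exists_adj_across (T := A)
          (fun x hx y hy hxy h' => hin x y hxy h' (iff_of_false hx hy)) hx.1 hsB
          (by simpa [hxA] using hs)
        exact ⟨z, fun h' => hz (iff_of_true hxA h'), hadj⟩
    refine Or.inr ⟨q, ?_, closeCuts_singleton hA' hq.1 h1,
      (closeCuts_singleton (A := Bᶜ) (by rwa [compl_compl]) hq.2 h2).of_compl_left.symm⟩
    -- The second vertex `q'` of `A \ B` links the two connected sets that together make up the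
    -- complement of `q`.
    have h3 := h1.union h2 ⟨q', ⟨hq'.1, hne.symm⟩, hq'.2, hne.symm⟩
    convert h3 using 1
    ext x
    by_cases hx : x ∈ A
    · simp [hx]
    · have : x ∉ B := fun h' => hx (h h')
      simp [hx, this]

/-- Two cuts crossing each other, without edges inside the four pieces. -/
structure IsCrossing (G : SimpleGraph X) (A B : Set X) : Prop where
  left : Conn G A
  left_compl : Conn G Aᶜ
  right : Conn G B
  right_compl : Conn G Bᶜ
  not_iff_of_adj : ∀ x y, G.Adj x y → (x ∈ A ↔ y ∈ A) → ¬ (x ∈ B ↔ y ∈ B)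
  nonempty₁ : (A ∩ B).Nonempty
  nonempty₂ : (A ∩ Bᶜ).Nonempty
  nonempty₃ : (Aᶜ ∩ B).Nonempty
  nonempty₄ : (Aᶜ ∩ Bᶜ).Nonempty

namespace IsCrossing

lemma symm (h : IsCrossing G A B) : IsCrossing G B A where
  left := h.right
  left_compl := h.right_compl
  right := h.left
  right_compl := h.left_compl
  not_iff_of_adj x y hxy hB hA := h.not_iff_of_adj x y hxy hA hB
  nonempty₁ := by rw [Set.inter_comm]; exact h.nonempty₁
  nonempty₂ := by rw [Set.inter_comm]; exact h.nonempty₃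
  nonempty₃ := by rw [Set.inter_comm]; exact h.nonempty₂
  nonempty₄ := by rw [Set.inter_comm]; exact h.nonempty₄

lemma compl_left (h : IsCrossing G A B) : IsCrossing G Aᶜ B where
  left := h.left_compl
  left_compl := by rw [compl_compl]; exact h.left
  right := h.right
  right_compl := h.right_compl
  not_iff_of_adj x y hxy hA hB := h.not_iff_of_adj x y hxy (not_iff_not.1 hA) hB
  nonempty₁ := h.nonempty₃
  nonempty₂ := h.nonempty₄
  nonempty₃ := by rw [compl_compl]; exact h.nonempty₁
  nonempty₄ := by rw [compl_compl]; exact h.nonempty₂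

lemma compl_right (h : IsCrossing G A B) : IsCrossing G A Bᶜ :=
  h.symm.compl_left.symm

/-- The side of `A` containing `x` is connected, meets `Bᶜ`, and all its inner edges cross `B`.
Consequently any part of `B` can be attached to the connected set `Bᶜ`. -/
lemma exists_adj (h : IsCrossing G A B) {x : X} (hx : x ∈ B) : ∃ y ∈ Bᶜ, G.Adj x y := by
  by_cases hxA : x ∈ A
  · obtain ⟨w, hw, hwB⟩ := h.nonempty₂
    obtain ⟨z, -, hadj, hz⟩ := h.left.exists_adj_across (T := B)
      (fun x hx y hy hxy => h.not_iff_of_adj x y hxy (iff_of_true hx hy)) hxA hw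
      (fun h' => hwB (h'.1 hx))
    exact ⟨z, fun h' => hz (iff_of_true hx h'), hadj⟩
  · obtain ⟨w, hw, hwB⟩ := h.nonempty₄
    obtain ⟨z, -, hadj, hz⟩ := h.left_compl.exists_adj_across (T := B)
      (fun x hx y hy hxy => h.not_iff_of_adj x y hxy (iff_of_false hx hy)) hxA hw
      (fun h' => hwB (h'.1 hx))
    exact ⟨z, fun h' => hz (iff_of_true hx h'), hadj⟩

lemma conn_compl (h : IsCrossing G A B) {M : Set X} (hM : M ⊆ B) : Conn G Mᶜ :=
  h.right_compl.compl_of_subset (fun _ hx => h.exists_adj hx) hM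

lemma conn_compl_singleton (h : IsCrossing G A B) (r : X) : Conn G ({r} : Set X)ᶜ := by
  by_cases hr : r ∈ B
  · exact h.conn_compl (Set.singleton_subset_iff.2 hr)
  · exact h.compl_right.conn_compl (Set.singleton_subset_iff.2 hr)

/-- `r` is not a cut vertex of its side of the cut `A`. -/
def _root_.PiZonotope.IsNoncut (G : SimpleGraph X) (A : Set X) (r : X) : Prop :=
  r ∈ A ∧ Conn G (A \ {r}) ∨ r ∈ Aᶜ ∧ Conn G (Aᶜ \ {r})

lemma closeCuts (h : IsCrossing G A B) {r : X} (hr : IsNoncut G A r) : CloseCuts G A {r} := by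
  rcases hr with ⟨hr, hc⟩ | ⟨hr, hc⟩
  · exact closeCuts_singleton h.left_compl hr hc
  · exact (closeCuts_singleton h.compl_left.left_compl hr hc).of_compl_left

lemma isMidVertex (h : IsCrossing G A B) {r : X} (hA : IsNoncut G A r) (hB : IsNoncut G B r) :
    IsMidVertex G A B r :=
  ⟨h.conn_compl_singleton r, h.closeCuts hA, (h.symm.closeCuts hB).symm⟩

lemma exists_two_noncut [Finite X] (h : IsCrossing G A B) :
    ∃ u ∈ A, ∃ v ∈ A, u ≠ v ∧ Conn G (A \ {u}) ∧ Conn G (A \ {v}) := by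
  obtain ⟨x, hxA, hxB⟩ := h.nonempty₁
  obtain ⟨y, hyA, hyB⟩ := h.nonempty₂
  have hxy : y ≠ x := by rintro rfl; exact hyB hxB
  obtain ⟨u, hu, hux, hcu⟩ := h.left.exists_noncut hxA hyA hxy
  obtain ⟨v, hv, hvu, hcv⟩ := h.left.exists_noncut hu hxA hux.symm
  exact ⟨u, hu, v, hv, hvu.symm, hcu, hcv⟩

lemma four_le_ncard_noncut [Finite X] (h : IsCrossing G A B) :
    4 ≤ {r | IsNoncut G A r}.ncard := by
  classical
  obtain ⟨u, hu, v, hv, huv, hcu, hcv⟩ := h.exists_two_noncut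
  obtain ⟨u', hu', v', hv', huv', hcu', hcv'⟩ := h.compl_left.exists_two_noncut
  have hne : ∀ x ∈ A, ∀ y ∈ Aᶜ, x ≠ y := by
    rintro x hx _ hy rfl
    exact hy hx
  have hcard : ({u, v, u', v'} : Finset X).card = 4 := by
    rw [Finset.card_insert_of_notMem, Finset.card_insert_of_notMem, Finset.card_pair huv']
    · simp [hne v hv u' hu', hne v hv v' hv']
    · simp [huv, hne u hu u' hu', hne u hu v' hv']
  rw [← hcard, ← Set.ncard_coe_finset]
  refine Set.ncard_le_ncard ?_ (Set.toFinite _)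
  intro x hx
  simp only [Finset.coe_insert, Finset.coe_singleton, Set.mem_insert_iff,
    Set.mem_singleton_iff] at hx
  rcases hx with rfl | rfl | rfl | rfl
  · exact Or.inl ⟨hu, hcu⟩
  · exact Or.inl ⟨hv, hcv⟩
  · exact Or.inr ⟨hu', hcu'⟩
  · exact Or.inr ⟨hv', hcv'⟩

lemma exists_isMidVertex [Finite X] (h : IsCrossing G A B) (hX : Nat.card X ≤ 7) :
    ∃ r, IsMidVertex G A B r := by
  have h1 := h.four_le_ncard_noncut
  have h2 := h.symm.four_le_ncard_noncut
  have h3 := Set.ncard_union_add_ncard_inter {r | IsNoncut G A r} {r | IsNoncut G B r}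
    (Set.toFinite _) (Set.toFinite _)
  have h4 := Set.ncard_le_card ({r | IsNoncut G A r} ∪ {r | IsNoncut G B r})
  -- Two sets of at least four vertices among at most seven must meet.
  have h5 : ({r | IsNoncut G A r} ∩ {r | IsNoncut G B r}).ncard ≠ 0 := by omega
  obtain ⟨r, hA, hB⟩ := Set.nonempty_of_ncard_ne_zero h5
  exact ⟨r, h.isMidVertex hA hB⟩

/-- The only obstruction to connecting the complement of `{l, m}` is a vertex `x` outside `A` and
`B` with no neighbour in `A ∪ B` other than `l` and `m`. Edges inside `Aᶜ` lead from `x` into `B`,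
so only to `m`; edges inside `Bᶜ` lead only to `l`. Thus `x` is a leaf on its side of both cuts. -/
lemma isMidVertex_or_closeCuts (h : IsCrossing G A B) {l m : X} (hl : l ∈ A) (hm : m ∈ B)
    (hcl : Conn G (A \ {l})) (hcm : Conn G (B \ {m})) :
    (∃ r, IsMidVertex G A B r) ∨ CloseCuts G {l} {m} := by
  by_cases hlm : l = m
  · subst hlm
    exact Or.inl ⟨l, h.isMidVertex (Or.inl ⟨hl, hcl⟩) (Or.inl ⟨hm, hcm⟩)⟩
  have hclose : Conn G ({l, m} : Set X)ᶜ → CloseCuts G {l} {m} :=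
    closeCuts_singleton_singleton hlm
  by_cases hlB : l ∈ B
  · exact Or.inr (hclose (h.conn_compl (Set.insert_subset hlB (Set.singleton_subset_iff.2 hm))))
  by_cases hmA : m ∈ A
  · exact Or.inr (hclose (h.symm.conn_compl
      (Set.insert_subset hl (Set.singleton_subset_iff.2 hmA))))
  have hW : Conn G (A \ {l} ∪ B \ {m}) := by
    obtain ⟨p, hpA, hpB⟩ := h.nonempty₁
    refine hcl.union hcm ⟨p, ⟨hpA, ?_⟩, hpB, ?_⟩
    · rintro rfl; exact hlB hpB
    · rintro rfl; exact hmA hpA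
  by_cases hall : ∀ x, x ∉ A → x ∉ B → ∃ y ∈ A \ {l} ∪ B \ {m}, G.Adj x y
  · refine Or.inr (hclose (hW.attach ?_ fun x hx hxW => hall x ?_ ?_))
    · rintro x (⟨hx, hxl⟩ | ⟨hx, hxm⟩) hx'
      · rcases hx' with rfl | rfl
        · exact hxl rfl
        · exact hmA hx
      · rcases hx' with rfl | rfl
        · exact hlB hx
        · exact hxm rfl
    · exact fun hxA => hxW (Or.inl ⟨hxA, fun h' => hx (Or.inl h')⟩)
    · exact fun hxB => hxW (Or.inr ⟨hxB, fun h' => hx (Or.inr h')⟩)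
  · push Not at hall
    obtain ⟨x, hxA, hxB, hx⟩ := hall
    refine Or.inl ⟨x, h.isMidVertex (Or.inr ⟨hxA, ?_⟩) (Or.inr ⟨hxB, ?_⟩)⟩
    · refine h.left_compl.diff_singleton_of_leaf (m := m) fun y hy hxy => ?_
      by_contra hym
      have hyB : y ∉ B := fun hyB => hx y (Or.inr ⟨hyB, hym⟩) hxy
      exact h.not_iff_of_adj x y hxy (iff_of_false hxA hy) (iff_of_false hxB hyB)
    · refine h.right_compl.diff_singleton_of_leaf (m := l) fun y hy hxy => ?_
      by_contra hyl
      have hyA : y ∉ A := fun hyA => hx y (Or.inl ⟨hyA, hyl⟩) hxy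
      exact h.not_iff_of_adj x y hxy (iff_of_false hxA hyA) (iff_of_false hxB hy)

end IsCrossing

/-- Two cuts without edges inside the pieces are joined by a path of cuts of length at most three,
and of length at most two if there are at most seven vertices. -/
theorem exists_path_of_cuts [Finite X] (hA : Conn G A) (hA' : Conn G Aᶜ) (hB : Conn G B)
    (hB' : Conn G Bᶜ) (hneA : A.Nonempty) (hneA' : Aᶜ.Nonempty) (hneB : B.Nonempty)
    (hneB' : Bᶜ.Nonempty)
    (hin : ∀ x y, G.Adj x y → (x ∈ A ↔ y ∈ A) → ¬ (x ∈ B ↔ y ∈ B)) :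
    AtMostTwo G A B ∨ (7 < Nat.card X ∧ ∃ l m, Conn G ({l} : Set X)ᶜ ∧ Conn G ({m} : Set X)ᶜ ∧
      CloseCuts G A {l} ∧ CloseCuts G {l} {m} ∧ CloseCuts G {m} B) := by
  by_cases h₁ : (A ∩ B).Nonempty
  swap
  · left
    refine AtMostTwo.of_compl_left (atMostTwo_of_subset hA' (by rwa [compl_compl]) hB hB'
      (by rwa [compl_compl]) hneB (fun x y hxy h => hin x y hxy (not_iff_not.1 h)) ?_)
    exact fun x hx hxA => h₁ ⟨x, hxA, hx⟩
  by_cases h₂ : (A ∩ Bᶜ).Nonempty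
  swap
  · left
    refine AtMostTwo.of_compl_left (AtMostTwo.of_compl_right (atMostTwo_of_subset hA'
      (by rwa [compl_compl]) hB' (by rwa [compl_compl]) (by rwa [compl_compl]) hneB'
      (fun x y hxy h h' => hin x y hxy (not_iff_not.1 h) (not_iff_not.1 h')) ?_))
    exact fun x hx hxA => h₂ ⟨x, hxA, hx⟩
  by_cases h₃ : (Aᶜ ∩ B).Nonempty
  swap
  · left
    refine atMostTwo_of_subset hA hA' hB hB' hneA' hneB hin fun x hx => ?_
    by_contra hxA
    exact h₃ ⟨x, hxA, hx⟩
  by_cases h₄ : (Aᶜ ∩ Bᶜ).Nonempty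
  swap
  · left
    refine AtMostTwo.of_compl_right (atMostTwo_of_subset hA hA' hB' (by rwa [compl_compl])
      hneA' hneB' (fun x y hxy h h' => hin x y hxy h (not_iff_not.1 h')) fun x hx => ?_)
    by_contra hxA
    exact h₄ ⟨x, hxA, hx⟩
  have h : IsCrossing G A B := ⟨hA, hA', hB, hB', hin, h₁, h₂, h₃, h₄⟩
  by_cases hX : Nat.card X ≤ 7
  · exact Or.inl (Or.inr (h.exists_isMidVertex hX))
  obtain ⟨l, hl, -, -, -, hcl, -⟩ := h.exists_two_noncut
  obtain ⟨m, hm, -, -, -, hcm, -⟩ := h.symm.exists_two_noncut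
  rcases h.isMidVertex_or_closeCuts hl hm hcl hcm with h' | h'
  · exact Or.inl (Or.inr h')
  · exact Or.inr ⟨not_le.1 hX, l, m, h.conn_compl_singleton l, h.conn_compl_singleton m,
      h.closeCuts (Or.inl ⟨hl, hcl⟩), h', (h.symm.closeCuts (Or.inl ⟨hm, hcm⟩)).symm⟩

end Connected

/-! ### Facet functions of a graph as connected cuts -/

section Coboundary

variable {ι X : Type*}

/-- The differences of a function on the vertices along the edges. -/
def cobd (s t : ι → X) : (X → ℝ) →ₗ[ℝ] (ι → ℝ) where
  toFun f e := f (s e) - f (t e)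
  map_add' f g := by ext e; simp; ring
  map_smul' c f := by ext e; simp; ring

@[simp] lemma cobd_apply (s t : ι → X) (f : X → ℝ) (e : ι) : cobd s t f e = f (s e) - f (t e) :=
  rfl

/-- The simple graph underlying a family of edges. -/
def edgeGraph (s t : ι → X) : SimpleGraph X where
  Adj x y := x ≠ y ∧ ∃ e, s e = x ∧ t e = y ∨ s e = y ∧ t e = x
  symm := ⟨fun _ _ h => ⟨h.1.symm, h.2.imp fun _ h => h.symm⟩⟩
  loopless := ⟨fun _ h => h.1 rfl⟩

variable {s t : ι → X} {A B : Set X}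

lemma eq_of_adj {f : X → ℝ} {x y : X} (h : (edgeGraph s t).Adj x y)
    (hf : ∀ e, s e = x ∧ t e = y ∨ s e = y ∧ t e = x → cobd s t f e = 0) : f x = f y := by
  obtain ⟨-, e, he⟩ := h
  have := hf e he
  rw [cobd_apply, sub_eq_zero] at this
  rcases he with ⟨rfl, rfl⟩ | ⟨rfl, rfl⟩
  · exact this
  · exact this.symm

lemma cobd_indicator_eq_zero_iff (A : Set X) (e : ι) :
    cobd s t (A.indicator 1) e = 0 ↔ (s e ∈ A ↔ t e ∈ A) := by
  classical
  by_cases h1 : s e ∈ A <;> by_cases h2 : t e ∈ A <;> simp [h1, h2]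

lemma CloseCuts.closeFn (h : CloseCuts (edgeGraph s t) A B) :
    CloseFn (LinearMap.range (cobd s t)) (cobd s t (A.indicator 1))
      (cobd s t (B.indicator 1)) := by
  rintro _ ⟨f, rfl⟩ hf
  obtain ⟨a, b, c, habc⟩ := h f fun x y hxy hA hB => eq_of_adj hxy fun e he => by
    refine hf e ((cobd_indicator_eq_zero_iff A e).2 ?_) ((cobd_indicator_eq_zero_iff B e).2 ?_)
    · rcases he with ⟨rfl, rfl⟩ | ⟨rfl, rfl⟩
      · exact hA
      · exact hA.symm
    · rcases he with ⟨rfl, rfl⟩ | ⟨rfl, rfl⟩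
      · exact hB
      · exact hB.symm
  refine ⟨a, b, ?_⟩
  ext e
  simp only [cobd_apply, Pi.add_apply, Pi.smul_apply, smul_eq_mul, habc]
  ring

lemma cobd_indicator_ne_zero (hconn : ∀ f : X → ℝ, cobd s t f = 0 → ∀ x y, f x = f y)
    (hne : A.Nonempty) (hne' : Aᶜ.Nonempty) : cobd s t (A.indicator 1) ≠ 0 := by
  classical
  intro h0
  obtain ⟨x, hx⟩ := hne
  obtain ⟨y, hy⟩ := hne'
  have := hconn _ h0 x y
  rw [Set.mem_compl_iff] at hy
  simp [hx, hy] at this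

lemma isFacetFn_of_conn (hconn : ∀ f : X → ℝ, cobd s t f = 0 → ∀ x y, f x = f y)
    (hA : Conn (edgeGraph s t) A) (hA' : Conn (edgeGraph s t) Aᶜ) (hne : A.Nonempty)
    (hne' : Aᶜ.Nonempty) :
    IsFacetFn (LinearMap.range (cobd s t)) (cobd s t (A.indicator 1)) := by
  classical
  refine ⟨LinearMap.mem_range_self _ _, cobd_indicator_ne_zero hconn hne hne', ?_⟩
  rintro _ ⟨f, rfl⟩ hf
  have hadj : ∀ x y, (edgeGraph s t).Adj x y → (x ∈ A ↔ y ∈ A) → f x = f y := fun x y hxy h =>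
    eq_of_adj hxy fun e he => hf e ((cobd_indicator_eq_zero_iff A e).2 (by
      rcases he with ⟨rfl, rfl⟩ | ⟨rfl, rfl⟩
      · exact h
      · exact h.symm))
  obtain ⟨a, ha⟩ := hA.exists_const (f := f)
    fun x hx y hy hxy => hadj x y hxy (iff_of_true hx hy)
  obtain ⟨b, hb⟩ := hA'.exists_const (f := f)
    fun x hx y hy hxy => hadj x y hxy (iff_of_false hx hy)
  have hfx : ∀ x, f x = (a - b) * A.indicator 1 x + b := fun x => by
    by_cases hx : x ∈ A
    · simp [hx, ha x hx]
    · simp [hx, hb x hx]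
  refine ⟨a - b, ?_⟩
  ext e
  simp only [cobd_apply, Pi.smul_apply, smul_eq_mul, hfx]
  ring

/-- A function constant along the edges inside `A`, extended by zero, changes only across the cut.
Its coboundary is then a multiple of that of the indicator, so the function is constant on `A`. -/
lemma conn_of_isFacetFn (hconn : ∀ f : X → ℝ, cobd s t f = 0 → ∀ x y, f x = f y)
    (h : IsFacetFn (LinearMap.range (cobd s t)) (cobd s t (A.indicator 1))) :
    Conn (edgeGraph s t) A := by
  classical
  intro f hf x hx y hy
  obtain ⟨c, hc⟩ := h.2.2 _ (LinearMap.mem_range_self _ (A.indicator f)) fun e he => by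
    rw [cobd_indicator_eq_zero_iff] at he
    by_cases hs : s e ∈ A
    · by_cases hst : s e = t e
      · simp [hst]
      · simp [hs, he.1 hs, hf _ hs _ (he.1 hs) ⟨hst, e, Or.inl ⟨rfl, rfl⟩⟩]
    · have ht : t e ∉ A := fun h => hs (he.2 h)
      simp [hs, ht]
  have := hconn (A.indicator f - c • A.indicator 1) (by rw [map_sub, map_smul, hc, sub_self]) x y
  simpa [hx, hy] using this

lemma cobd_indicator_compl (A : Set X) :
    cobd s t (Aᶜ.indicator 1) = (-1 : ℝ) • cobd s t (A.indicator 1) := by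
  classical
  ext e
  by_cases h1 : s e ∈ A <;> by_cases h2 : t e ∈ A <;> simp [h1, h2]

lemma IsFacetFn.of_smul {D : Submodule ℝ (ι → ℝ)} {φ : ι → ℝ} {c : ℝ} (hc : c ≠ 0)
    (h : IsFacetFn D φ) : IsFacetFn D (c • φ) := by
  refine ⟨D.smul_mem c h.1, smul_ne_zero hc h.2.1, fun ψ hψ hz => ?_⟩
  obtain ⟨a, rfl⟩ := h.2.2 ψ hψ fun e he => hz e (by simp [he])
  exact ⟨a / c, by rw [smul_smul, div_mul_cancel₀ _ hc]⟩

lemma CloseFn.of_smul {D : Submodule ℝ (ι → ℝ)} {φ ψ : ι → ℝ} {c : ℝ} (hc : c ≠ 0)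
    (h : CloseFn D φ ψ) : CloseFn D (c • φ) ψ := by
  intro χ hχ hz
  obtain ⟨a, b, rfl⟩ := h χ hχ fun e h1 h2 => hz e (by simp [h1]) h2
  exact ⟨a / c, b, by rw [smul_smul, div_mul_cancel₀ _ hc]⟩

lemma CloseFn.symm {D : Submodule ℝ (ι → ℝ)} {φ ψ : ι → ℝ} (h : CloseFn D φ ψ) :
    CloseFn D ψ φ := by
  intro χ hχ hz
  obtain ⟨a, b, rfl⟩ := h χ hχ fun e h1 h2 => hz e h2 h1
  exact ⟨b, a, add_comm _ _⟩

/-- Facets of a connected graph correspond to cuts with two connected sides. -/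
lemma exists_cut_of_isFacetFn (hconn : ∀ f : X → ℝ, cobd s t f = 0 → ∀ x y, f x = f y)
    {φ : ι → ℝ} (h : IsFacetFn (LinearMap.range (cobd s t)) φ) :
    ∃ (A : Set X) (c : ℝ), c ≠ 0 ∧ φ = c • cobd s t (A.indicator 1) ∧
      Conn (edgeGraph s t) A ∧ Conn (edgeGraph s t) Aᶜ ∧ A.Nonempty ∧ Aᶜ.Nonempty := by
  classical
  obtain ⟨⟨f, rfl⟩, hne, hz⟩ := h
  obtain ⟨e, he⟩ := Function.ne_iff.1 hne
  -- The indicator of a level set of `f` does not change along edges where `f` does not, so its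
  -- coboundary is a multiple of that of `f`.
  set A : Set X := {x | f x = f (s e)} with hA
  have hneA : A.Nonempty := ⟨s e, rfl⟩
  have hneA' : Aᶜ.Nonempty := ⟨t e, fun h : f (t e) = f (s e) => he (by simp [h])⟩
  obtain ⟨c, hc⟩ := hz _ (LinearMap.mem_range_self _ (A.indicator 1)) fun e' he' => by
    rw [cobd_indicator_eq_zero_iff]
    rw [cobd_apply, sub_eq_zero] at he'
    simp [hA, he']
  have hc0 : c ≠ 0 := by
    rintro rfl
    exact cobd_indicator_ne_zero hconn hneA hneA' (by rw [hc, zero_smul])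
  have hfac : IsFacetFn (LinearMap.range (cobd s t)) (cobd s t (A.indicator 1)) := by
    rw [hc]
    exact IsFacetFn.of_smul hc0 ⟨LinearMap.mem_range_self _ _, hne, hz⟩
  refine ⟨A, c⁻¹, inv_ne_zero hc0, ?_, conn_of_isFacetFn hconn hfac,
    conn_of_isFacetFn hconn ?_, hneA, hneA'⟩
  · rw [hc, smul_smul, inv_mul_cancel₀ hc0, one_smul]
  · rw [cobd_indicator_compl]
    exact hfac.of_smul (by norm_num)

end Coboundary

/-! ### Connecting and contracting the representing graph -/

section Representation

variable {ι : Type*}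

lemma cobd_quotient {X : Type*} {s t : ι → X} (r : Setoid X) (g : Quotient r → ℝ) :
    cobd (fun e => Quotient.mk r (s e)) (fun e => Quotient.mk r (t e)) g =
      cobd s t (fun x => g (Quotient.mk r x)) := rfl

/-- The points which the functions in `S` do not separate. -/
def inseparable {X : Type*} (S : Set (X → ℝ)) : Setoid X where
  r x y := ∀ f ∈ S, f x = f y
  iseqv := ⟨fun _ _ _ => rfl, fun h f hf => (h f hf).symm,
    fun h h' f hf => (h f hf).trans (h' f hf)⟩

/-- Passing to a quotient graph, a graph may be assumed to be connected. -/
lemma exists_connected_representation {D : Submodule ℝ (ι → ℝ)} {X : Type} [Finite X]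
    {s t : ι → X} (h : LinearMap.range (cobd s t) = D) :
    ∃ (Y : Type) (_ : Finite Y) (s' t' : ι → Y), LinearMap.range (cobd s' t') = D ∧
      ∀ f : Y → ℝ, cobd s' t' f = 0 → ∀ x y, f x = f y := by
  induction hn : Nat.card X using Nat.strong_induction_on generalizing X with
  | _ n ih =>
    subst hn
    by_cases hconn : ∀ f : X → ℝ, cobd s t f = 0 → ∀ x y, f x = f y
    · exact ⟨X, inferInstance, s, t, h, hconn⟩
    push Not at hconn
    obtain ⟨f, hf, x, y, hxy⟩ := hconn
    -- Gluing two vertices from different components leaves the space of coboundaries unchanged.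
    let r : Setoid X := inseparable {ρ | ρ x = ρ y}
    have hmk : Quotient.mk r x = Quotient.mk r y := Quotient.sound fun ρ hρ => hρ
    refine ih (Nat.card (Quotient r)) ?_ (X := Quotient r) (s := fun e => Quotient.mk r (s e))
      (t := fun e => Quotient.mk r (t e)) ?_ rfl
    · by_contra hle
      have hinj := (Function.Surjective.bijective_of_nat_card_le
        (f := Quotient.mk r) Quotient.mk_surjective (not_lt.1 hle)).1
      exact hxy (congrArg f (hinj hmk))
    · rw [← h]
      apply le_antisymm
      · rintro _ ⟨g, rfl⟩
        exact ⟨fun x => g (Quotient.mk r x), rfl⟩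
      · rintro _ ⟨ρ, rfl⟩
        -- Subtracting a multiple of `f`, which has zero coboundary, equalises the values at `x` and
        -- `y`.
        set ρ' : X → ℝ := ρ - ((ρ x - ρ y) / (f x - f y)) • f with hρ'
        have hxy' : f x - f y ≠ 0 := sub_ne_zero.2 hxy
        have hmem : ρ' x = ρ' y := by
          simp only [hρ', Pi.sub_apply, Pi.smul_apply, smul_eq_mul]
          field_simp
          ring
        refine ⟨Quotient.lift ρ' fun a b hab => hab ρ' hmem, ?_⟩
        rw [cobd_quotient]
        change cobd s t ρ' = _
        rw [hρ', map_sub, map_smul, hf, smul_zero, sub_zero]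

/-- The functions in `D` that vanish at the common zeros of `φ` and `ψ`. -/
def contraction (D : Submodule ℝ (ι → ℝ)) (φ ψ : ι → ℝ) : Submodule ℝ (ι → ℝ) where
  carrier := {χ | χ ∈ D ∧ ∀ e, φ e = 0 → ψ e = 0 → χ e = 0}
  zero_mem' := ⟨D.zero_mem, fun _ _ _ => rfl⟩
  add_mem' ha hb := ⟨D.add_mem ha.1 hb.1, fun e h1 h2 => by
    rw [Pi.add_apply, ha.2 e h1 h2, hb.2 e h1 h2, add_zero]⟩
  smul_mem' c _ ha := ⟨D.smul_mem c ha.1, fun e h1 h2 => by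
    rw [Pi.smul_apply, ha.2 e h1 h2, smul_zero]⟩

/-- This is contraction of the common zero edges: vertices are identified when no admissible
function separates them. Contracted edges survive as loops. -/
lemma exists_representation_contraction {D : Submodule ℝ (ι → ℝ)} {X : Type} [Finite X]
    {s t : ι → X} (h : LinearMap.range (cobd s t) = D) (φ ψ : ι → ℝ) :
    ∃ (Y : Type) (_ : Finite Y) (s' t' : ι → Y),
      LinearMap.range (cobd s' t') = contraction D φ ψ := by
  let r : Setoid X := inseparable {f | cobd s t f ∈ contraction D φ ψ}
  refine ⟨Quotient r, inferInstance, fun e => Quotient.mk r (s e), fun e => Quotient.mk r (t e),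
    le_antisymm ?_ ?_⟩
  · rintro _ ⟨g, rfl⟩
    refine ⟨h ▸ ⟨fun x => g (Quotient.mk r x), rfl⟩, fun e h1 h2 => ?_⟩
    have : Quotient.mk r (s e) = Quotient.mk r (t e) :=
      Quotient.sound fun f hf => sub_eq_zero.1 (hf.2 e h1 h2)
    rw [cobd_apply, this, sub_self]
  · intro χ hχ
    obtain ⟨f, rfl⟩ : χ ∈ LinearMap.range (cobd s t) := h ▸ hχ.1
    exact ⟨Quotient.lift f fun a b hab => hab f hχ, rfl⟩

lemma IsFacetFn.mono {D D' : Submodule ℝ (ι → ℝ)} (hD : D' ≤ D) {φ : ι → ℝ}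
    (h : IsFacetFn D φ) (hφ : φ ∈ D') : IsFacetFn D' φ :=
  ⟨hφ, h.2.1, fun ψ hψ => h.2.2 ψ (hD hψ)⟩

variable {D : Submodule ℝ (ι → ℝ)} {φ ψ χ χ' : ι → ℝ}

lemma IsFacetFn.of_contraction (h : IsFacetFn (contraction D φ ψ) χ) : IsFacetFn D χ :=
  ⟨h.1.1, h.2.1, fun ψ' hψ' hz => h.2.2 ψ' ⟨hψ', fun e h1 h2 => hz e (h.1.2 e h1 h2)⟩ hz⟩

lemma CloseFn.of_contraction (h : CloseFn (contraction D φ ψ) χ χ')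
    (hχ : χ ∈ contraction D φ ψ) (hχ' : χ' ∈ contraction D φ ψ) : CloseFn D χ χ' :=
  fun ω hω hz => h ω ⟨hω, fun e h1 h2 => hz e (hχ.2 e h1 h2) (hχ'.2 e h1 h2)⟩ hz

/-- By connectedness the kernel of the coboundary consists of constants; rank-nullity gives the
bound. -/
lemma card_le_finrank_add_one [Finite ι] {X : Type*} [Finite X] {s t : ι → X}
    (hconn : ∀ f : X → ℝ, cobd s t f = 0 → ∀ x y, f x = f y) :
    Nat.card X ≤ Module.finrank ℝ (LinearMap.range (cobd s t)) + 1 := by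
  have := Fintype.ofFinite X
  have h1 := LinearMap.finrank_range_add_finrank_ker (cobd s t)
  rw [Module.finrank_fintype_fun_eq_card] at h1
  have h2 : Module.finrank ℝ (LinearMap.ker (cobd s t)) ≤ 1 := by
    refine finrank_le_one (⟨1, by ext e; simp⟩ : LinearMap.ker (cobd s t)) fun ⟨f, hf⟩ => ?_
    rcases isEmpty_or_nonempty X with hX | ⟨⟨x⟩⟩
    · exact ⟨0, Subtype.ext (funext fun y => hX.elim y)⟩
    · exact ⟨f x, Subtype.ext (funext fun y => by simpa using hconn f hf x y)⟩
  rw [Nat.card_eq_fintype_card]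
  omega

/-- Any two facets are at distance at most three, and at most two in dimension at most six. -/
theorem exists_path_of_facets [Finite ι] {X : Type} [Finite X]
    {s t : ι → X} (h : LinearMap.range (cobd s t) = D) (hφ : IsFacetFn D φ)
    (hψ : IsFacetFn D ψ) :
    CloseFn D φ ψ ∨ (∃ χ, IsFacetFn D χ ∧ CloseFn D φ χ ∧ CloseFn D χ ψ) ∨
      (6 < Module.finrank ℝ D ∧ ∃ χ χ', IsFacetFn D χ ∧ IsFacetFn D χ' ∧ CloseFn D φ χ ∧
        CloseFn D χ χ' ∧ CloseFn D χ' ψ) := by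
  classical
  obtain ⟨X', _, s', t', h'⟩ := exists_representation_contraction h φ ψ
  obtain ⟨Y, _, u, w, hD, hconn⟩ := exists_connected_representation h'
  have hle : contraction D φ ψ ≤ D := fun χ hχ => hχ.1
  have hφK : φ ∈ contraction D φ ψ := ⟨hφ.1, fun e h1 _ => h1⟩
  have hψK : ψ ∈ contraction D φ ψ := ⟨hψ.1, fun e _ h2 => h2⟩
  have hφ' := hφ.mono hle hφK
  have hψ' := hψ.mono hle hψK
  rw [← hD] at hφ' hψ'
  obtain ⟨A, a, ha, hφA, hA, hA', hneA, hneA'⟩ := exists_cut_of_isFacetFn hconn hφ'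
  obtain ⟨B, b, hb, hψB, hB, hB', hneB, hneB'⟩ := exists_cut_of_isFacetFn hconn hψ'
  -- An edge crossing neither cut is a common zero of `φ` and `ψ`, so no function on the contracted
  -- graph separates its ends; the indicator of one end does.
  have hin : ∀ x y, (edgeGraph u w).Adj x y → (x ∈ A ↔ y ∈ A) → ¬ (x ∈ B ↔ y ∈ B) := by
    intro x y hxy h1 h2
    have hz : ∀ f : Y → ℝ, f x = f y := fun f => eq_of_adj hxy fun e he => by
      have hf : cobd u w f ∈ contraction D φ ψ := hD ▸ LinearMap.mem_range_self _ f
      refine hf.2 e ?_ ?_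
      · rw [hφA, Pi.smul_apply, (cobd_indicator_eq_zero_iff A e).2, smul_zero]
        rcases he with ⟨rfl, rfl⟩ | ⟨rfl, rfl⟩
        · exact h1
        · exact h1.symm
      · rw [hψB, Pi.smul_apply, (cobd_indicator_eq_zero_iff B e).2, smul_zero]
        rcases he with ⟨rfl, rfl⟩ | ⟨rfl, rfl⟩
        · exact h2
        · exact h2.symm
    have := hz (Set.indicator {x} 1)
    rw [Set.indicator_of_mem (Set.mem_singleton x),
      Set.indicator_of_notMem (by simpa using hxy.1.symm)] at this
    exact one_ne_zero this
  have hcompl : ∀ r : Y, ({r} : Set Y)ᶜ.Nonempty := by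
    intro r
    by_contra hr
    rw [Set.not_nonempty_iff_eq_empty, Set.compl_empty_iff] at hr
    obtain ⟨x, hx⟩ := hneA
    obtain ⟨y, hy⟩ := hneA'
    have h1 : x ∈ ({r} : Set Y) := hr ▸ Set.mem_univ x
    have h2 : y ∈ ({r} : Set Y) := hr ▸ Set.mem_univ y
    exact hy (by rw [Set.mem_singleton_iff.1 h2, ← Set.mem_singleton_iff.1 h1]; exact hx)
  have hfacet : ∀ r : Y, Conn (edgeGraph u w) ({r} : Set Y)ᶜ →
      IsFacetFn D (cobd u w (Set.indicator {r} 1)) := fun r hr => by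
    have := isFacetFn_of_conn hconn (conn_singleton r) hr (Set.singleton_nonempty r) (hcompl r)
    rw [hD] at this
    exact this.of_contraction
  have hclose : ∀ S T : Set Y, CloseCuts (edgeGraph u w) S T →
      CloseFn D (cobd u w (S.indicator 1)) (cobd u w (T.indicator 1)) := fun S T hST => by
    have := hST.closeFn
    rw [hD] at this
    exact this.of_contraction (hD ▸ LinearMap.mem_range_self _ _)
      (hD ▸ LinearMap.mem_range_self _ _)
  have hcloseA : ∀ T : Set Y, CloseCuts (edgeGraph u w) A T →
      CloseFn D φ (cobd u w (T.indicator 1)) := fun T hT => by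
    rw [hφA]; exact (hclose A T hT).of_smul ha
  have hcloseB : ∀ T : Set Y, CloseCuts (edgeGraph u w) T B →
      CloseFn D (cobd u w (T.indicator 1)) ψ := fun T hT => by
    rw [hψB]; exact ((hclose T B hT).symm.of_smul hb).symm
  rcases exists_path_of_cuts hA hA' hB hB' hneA hneA' hneB hneB' hin with
    (h1 | ⟨r, h1, h2, h3⟩) | ⟨hcard, l, m, h1, h2, h3, h4, h5⟩
  · left
    rw [hψB]
    exact ((hcloseA B h1).symm.of_smul hb).symm
  · exact Or.inr (Or.inl ⟨_, hfacet r h1, hcloseA _ h2, hcloseB _ h3⟩)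
  · refine Or.inr (Or.inr ⟨?_, _, _, hfacet l h1, hfacet m h2, hcloseA _ h3, hclose _ _ h4,
      hcloseB _ h5⟩)
    have h6 := card_le_finrank_add_one hconn
    rw [hD] at h6
    have h7 := Submodule.finrank_mono hle
    omega

end Representation

/-! ### The upper bounds for Π-zonotopes -/

section UpperBound

lemma finrank_functionals_le {E : Type*} [NormedAddCommGroup E] [NormedSpace ℝ E]
    [FiniteDimensional ℝ E] (V : Finset E) :
    Module.finrank ℝ (functionals V) ≤ Module.finrank ℝ (Submodule.span ℝ (V : Set E)) := by
  let U := Submodule.span ℝ (V : Set E)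
  let ev : Module.Dual ℝ U →ₗ[ℝ] (V → ℝ) :=
    { toFun := fun g v => g ⟨v, Submodule.subset_span v.2⟩
      map_add' := fun _ _ => rfl
      map_smul' := fun _ _ => rfl }
  have hle : functionals V ≤ LinearMap.range ev := by
    rintro _ ⟨l, rfl⟩
    exact ⟨(l : E →ₗ[ℝ] ℝ).domRestrict U, rfl⟩
  calc Module.finrank ℝ (functionals V) ≤ Module.finrank ℝ (LinearMap.range ev) :=
        Submodule.finrank_mono hle
    _ ≤ Module.finrank ℝ (Module.Dual ℝ U) := LinearMap.finrank_range_le ev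
    _ = Module.finrank ℝ U := Subspace.dual_finrank_eq

variable {n : ℕ}

/-- The functional with given values on the standard basis. -/
def functionalOf (f : Fin (n + 1) → ℝ) : EuclideanSpace ℝ (Fin (n + 1)) →L[ℝ] ℝ :=
  ∑ i, f i • EuclideanSpace.proj i

@[simp] lemma functionalOf_single (f : Fin (n + 1) → ℝ) (i : Fin (n + 1)) :
    functionalOf f (EuclideanSpace.single i 1) = f i := by
  simp [functionalOf]

lemma functionalOf_zoneVector (f : Fin (n + 1) → ℝ) (i j : Fin (n + 1)) :
    functionalOf f (zoneVector i j) = f i - f j := by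
  rw [zoneVector, map_sub, functionalOf_single, functionalOf_single]

lemma exists_representation_functionals {V : Finset (EuclideanSpace ℝ (Fin (n + 1)))}
    (hV : (V : Set (EuclideanSpace ℝ (Fin (n + 1)))) ⊆ permutahedronZoneVectors n) :
    ∃ s t : V → Fin (n + 1), LinearMap.range (cobd s t) = functionals V := by
  choose s t hst using fun v : V => hV v.2
  refine ⟨s, t, le_antisymm ?_ ?_⟩
  · rintro _ ⟨f, rfl⟩
    refine ⟨functionalOf f, ?_⟩
    ext v
    rw [restrict_apply, (hst v).2, functionalOf_zoneVector, cobd_apply]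
  · rintro _ ⟨l, rfl⟩
    refine ⟨fun i => l (EuclideanSpace.single i 1), ?_⟩
    ext v
    rw [restrict_apply, (hst v).2, zoneVector, map_sub, cobd_apply]

/-- The upper bounds on the belt diameter. -/
theorem beltDiameter_le {P : Set (EuclideanSpace ℝ (Fin (n + 1)))} (hP : IsPiZonotope n P) :
    beltDiameter P ≤ 3 ∧ (dim P ≤ 6 → beltDiameter P ≤ 2) := by
  obtain ⟨V, t, hV, rfl⟩ := hP
  obtain ⟨s, t', hst⟩ := exists_representation_functionals hV
  have key : ∀ p q, (venkovGraph (t +ᵥ zonotope V)).edist p q ≤ 2 ∨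
      6 < dim (t +ᵥ zonotope V) ∧ (venkovGraph (t +ᵥ zonotope V)).edist p q ≤ 3 := by
    intro p q
    obtain ⟨l, hl, rfl⟩ := exists_eq_facetPair t p
    obtain ⟨m, hm, rfl⟩ := exists_eq_facetPair t q
    rcases exists_path_of_facets hst hl hm with h | ⟨_, hk, h1, h2⟩ |
      ⟨hd, _, _, hk, hk', h1, h2, h3⟩
    · exact Or.inl ((edist_facetPair_le_one t hl hm h).trans (by norm_num))
    · obtain ⟨k, rfl⟩ := hk.1
      refine Or.inl ((SimpleGraph.edist_triangle (v := facetPair V t k hk)).trans ?_)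
      exact (add_le_add (edist_facetPair_le_one t hl hk h1)
        (edist_facetPair_le_one t hk hm h2)).trans_eq one_add_one_eq_two
    · obtain ⟨k, rfl⟩ := hk.1
      obtain ⟨k', rfl⟩ := hk'.1
      refine Or.inr ⟨?_, (SimpleGraph.edist_triangle (v := facetPair V t k' hk')).trans ?_⟩
      · rw [dim_vadd_zonotope]
        exact hd.trans_le (finrank_functionals_le V)
      · have h4 := SimpleGraph.edist_triangle (G := venkovGraph (t +ᵥ zonotope V))
          (u := facetPair V t l hl) (v := facetPair V t k hk) (w := facetPair V t k' hk')
        have h5 := (add_le_add (edist_facetPair_le_one t hl hk h1)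
          (edist_facetPair_le_one t hk hk' h2)).trans_eq one_add_one_eq_two
        exact (add_le_add (h4.trans h5) (edist_facetPair_le_one t hk' hm h3)).trans_eq
          two_add_one_eq_three
  constructor
  · refine SimpleGraph.ediam_le_iff.2 fun p q => ?_
    rcases key p q with h | h
    · exact h.trans (by norm_num)
    · exact h.2
  · intro hd
    refine SimpleGraph.ediam_le_iff.2 fun p q => ?_
    rcases key p q with h | h
    · exact h
    · exact absurd h.1 (not_lt.2 hd)

end UpperBound

/-! ### Criteria for lower bounds on the belt diameter -/

section LowerBound

variable {n : ℕ}

open Classical in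
/-- The zone vectors of the edges of a graph. -/
def zoneVectors (Ed : Finset (Fin (n + 1) × Fin (n + 1))) :
    Finset (EuclideanSpace ℝ (Fin (n + 1))) :=
  Ed.image fun p => zoneVector p.1 p.2

variable {Ed : Finset (Fin (n + 1) × Fin (n + 1))}

lemma mem_zoneVectors {v : EuclideanSpace ℝ (Fin (n + 1))} :
    v ∈ zoneVectors Ed ↔ ∃ e ∈ Ed, zoneVector e.1 e.2 = v := by
  simp only [zoneVectors, Finset.mem_image]

lemma isPiZonotope_zoneVectors (h : ∀ e ∈ Ed, e.1 < e.2) :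
    IsPiZonotope n (zonotope (zoneVectors Ed)) := by
  refine ⟨zoneVectors Ed, 0, fun v hv => ?_, (zero_vadd _ _).symm⟩
  obtain ⟨e, he, rfl⟩ := mem_zoneVectors.1 hv
  exact ⟨e.1, e.2, h e he, rfl⟩

/-- Every function constant along the edges is constant. -/
def IsConn (Ed : Finset (Fin (n + 1) × Fin (n + 1))) : Prop :=
  ∀ f : Fin (n + 1) → ℝ, (∀ e ∈ Ed, f e.1 = f e.2) → ∀ x y, f x = f y

/-- By connectedness the annihilator of the zone vectors is spanned by the sum of the coordinates.
-/
lemma finrank_span_zoneVectors (h : IsConn Ed) :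
    Module.finrank ℝ
      (Submodule.span ℝ (zoneVectors Ed : Set (EuclideanSpace ℝ (Fin (n + 1))))) = n := by
  set U := Submodule.span ℝ (zoneVectors Ed : Set (EuclideanSpace ℝ (Fin (n + 1))))
  have h1 := Subspace.finrank_add_finrank_dualAnnihilator_eq U
  rw [finrank_euclideanSpace_fin] at h1
  have hmem : (functionalOf (fun _ : Fin (n + 1) => (1 : ℝ)) :
      EuclideanSpace ℝ (Fin (n + 1)) →ₗ[ℝ] ℝ) ∈ U.dualAnnihilator := by
    rw [Submodule.mem_dualAnnihilator]
    intro w hw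
    refine eq_zero_of_mem_span (fun v hv => ?_) hw
    obtain ⟨e, -, rfl⟩ := mem_zoneVectors.1 hv
    rw [functionalOf_zoneVector, sub_self]
  have h2 : Module.finrank ℝ U.dualAnnihilator = 1 := by
    refine finrank_eq_one (⟨_, hmem⟩ : U.dualAnnihilator) (fun h0 => ?_) fun ⟨w, hw⟩ => ?_
    · have := LinearMap.congr_fun (congrArg Subtype.val h0)
        (EuclideanSpace.single (0 : Fin (n + 1)) (1 : ℝ))
      simp at this
    · rw [Submodule.mem_dualAnnihilator] at hw
      have hc := h (fun i => w (EuclideanSpace.single i 1)) fun e he => by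
        have := hw _ (Submodule.subset_span (mem_zoneVectors.2 ⟨e, he, rfl⟩))
        rwa [zoneVector, map_sub, sub_eq_zero] at this
      refine ⟨w (EuclideanSpace.single 0 1), Subtype.ext ?_⟩
      refine (EuclideanSpace.basisFun (Fin (n + 1)) ℝ).toBasis.ext fun i => ?_
      simpa using hc 0 i
  omega

lemma dim_zonotope_zoneVectors (h : IsConn Ed) : dim (zonotope (zoneVectors Ed)) = n := by
  rw [← zero_vadd (EuclideanSpace ℝ (Fin (n + 1))) (zonotope _), dim_vadd_zonotope,
    finrank_span_zoneVectors h]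

/-- The cut `A` is crossed by an edge and has two connected sides. -/
structure IsBond (Ed : Finset (Fin (n + 1) × Fin (n + 1))) (A : Fin (n + 1) → Bool) : Prop where
  exists_const : ∀ f : Fin (n + 1) → ℝ, (∀ e ∈ Ed, A e.1 = A e.2 → f e.1 = f e.2) →
    ∃ a b, ∀ x, f x = if A x then a else b
  exists_crossing : ∃ e ∈ Ed, A e.1 ≠ A e.2

/-- The functional that is one on the side `A` and zero on the other side. -/
def cutFunctional (A : Fin (n + 1) → Bool) : EuclideanSpace ℝ (Fin (n + 1)) →L[ℝ] ℝ :=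
  functionalOf fun i => if A i then 1 else 0

lemma cutFunctional_eq_zero_iff {A : Fin (n + 1) → Bool} {i j : Fin (n + 1)} :
    cutFunctional A (zoneVector i j) = 0 ↔ A i = A j := by
  rw [cutFunctional, functionalOf_zoneVector]
  cases A i <;> cases A j <;> simp

variable {A B : Fin (n + 1) → Bool}

lemma IsBond.isFacetFn (h : IsBond Ed A) :
    IsFacetFn (functionals (zoneVectors Ed)) (restrict (zoneVectors Ed) (cutFunctional A)) := by
  refine ⟨restrict_mem _ _, ?_, ?_⟩
  · obtain ⟨e, he, hne⟩ := h.exists_crossing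
    intro h0
    exact hne (cutFunctional_eq_zero_iff.1
      (congrFun h0 ⟨zoneVector e.1 e.2, mem_zoneVectors.2 ⟨e, he, rfl⟩⟩))
  · rintro _ ⟨l, rfl⟩ hl
    obtain ⟨a, b, hab⟩ := h.exists_const (fun i => l (EuclideanSpace.single i 1))
      fun e he hA => by
        have : l (zoneVector e.1 e.2) = 0 :=
          hl ⟨zoneVector e.1 e.2, mem_zoneVectors.2 ⟨e, he, rfl⟩⟩ (cutFunctional_eq_zero_iff.2 hA)
        rwa [zoneVector, map_sub, sub_eq_zero] at this
    refine ⟨a - b, ?_⟩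
    ext ⟨v, hv⟩
    obtain ⟨e, -, rfl⟩ := mem_zoneVectors.1 hv
    have h1 := hab e.1
    have h2 := hab e.2
    change l (zoneVector e.1 e.2) = (a - b) * cutFunctional A (zoneVector e.1 e.2)
    rw [cutFunctional, functionalOf_zoneVector, zoneVector, map_sub, h1, h2]
    cases A e.1 <;> cases A e.2 <;> simp

lemma card_filter_zoneVectors_le (p : EuclideanSpace ℝ (Fin (n + 1)) → Prop) [DecidablePred p]
    (q : Fin (n + 1) × Fin (n + 1) → Prop) [DecidablePred q]
    (h : ∀ e ∈ Ed, p (zoneVector e.1 e.2) → q e) :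
    ((zoneVectors Ed).filter p).card ≤ (Ed.filter q).card := by
  classical
  refine (Finset.card_le_card (t := (Ed.filter q).image fun e => zoneVector e.1 e.2)
    fun v hv => ?_).trans Finset.card_image_le
  obtain ⟨hv, hp⟩ := Finset.mem_filter.1 hv
  obtain ⟨e, he, rfl⟩ := mem_zoneVectors.1 hv
  exact Finset.mem_image.2 ⟨e, Finset.mem_filter.2 ⟨he, h e he hp⟩, rfl⟩

/-- Two bonds that leave few common edges are not adjacent. -/
theorem two_le_beltDiameter (hconn : IsConn Ed) (hA : IsBond Ed A) (hB : IsBond Ed B)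
    (hcard : (Ed.filter fun e => A e.1 = A e.2 ∧ B e.1 = B e.2).card + 2 < n) :
    2 ≤ beltDiameter (zonotope (zoneVectors Ed)) := by
  rw [← zero_vadd (EuclideanSpace ℝ (Fin (n + 1))) (zonotope _)]
  by_contra hlt
  replace hlt := (ENat.lt_add_one_iff ENat.one_ne_top).1
    ((not_le.1 hlt).trans_eq one_add_one_eq_two.symm)
  have h1 := finrank_le_card_of_edist_le_one 0 hA.isFacetFn hB.isFacetFn
    (SimpleGraph.edist_le_ediam.trans hlt)
  rw [finrank_span_zoneVectors hconn] at h1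
  have h2 := card_filter_zoneVectors_le (Ed := Ed)
    (fun v => cutFunctional A v = 0 ∧ cutFunctional B v = 0)
    (fun e => A e.1 = A e.2 ∧ B e.1 = B e.2) fun e _ h =>
      h.imp cutFunctional_eq_zero_iff.1 cutFunctional_eq_zero_iff.1
  omega

lemma exists_middle_of_edist_le_two {W : Type*} {G : SimpleGraph W} {p q : W}
    (h : G.edist p q ≤ 2) : ∃ r, G.edist p r ≤ 1 ∧ G.edist r q ≤ 1 := by
  by_cases h1 : G.edist p q ≤ 1
  · exact ⟨p, by simp, h1⟩
  · by_contra! hr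
    refine not_lt.2 h (SimpleGraph.two_lt_edist_iff.2 ?_)
    rw [SimpleGraph.edist_le_one_iff_adj_or_eq, not_or] at h1
    refine ⟨h1.2, h1.1, Set.eq_empty_of_forall_notMem fun r hr' => ?_⟩
    have h2 := hr r (SimpleGraph.edist_le_one_iff_adj_or_eq.2 (Or.inl hr'.1))
    exact not_le.2 h2 (SimpleGraph.edist_le_one_iff_adj_or_eq.2 (Or.inl hr'.2.symm))

/-- The function `f` changes along at most one of the edges that do not cross the cut `A`. -/
def ChangesOnce (Ed : Finset (Fin (n + 1) × Fin (n + 1))) (A : Fin (n + 1) → Bool)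
    {R : Type*} (f : Fin (n + 1) → R) : Prop :=
  ∀ e ∈ Ed, ∀ e' ∈ Ed, A e.1 = A e.2 → A e'.1 = A e'.2 → f e.1 ≠ f e.2 → f e'.1 ≠ f e'.2 → e = e'

/-- At most `n - 1` edges do not cross `A`, and a pair at distance at most one shares at least `n -
2` of them as zeros; only one can be lost. -/
lemma changesOnce_of_edist_le_one (hconn : IsConn Ed)
    (hA : IsBond Ed A) (hcard : (Ed.filter fun e => A e.1 = A e.2).card + 1 ≤ n)
    {k : EuclideanSpace ℝ (Fin (n + 1)) →L[ℝ] ℝ}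
    (hk : IsFacetFn (functionals (zoneVectors Ed)) (restrict (zoneVectors Ed) k))
    (h : (venkovGraph ((0 : EuclideanSpace ℝ (Fin (n + 1))) +ᵥ zonotope (zoneVectors Ed))).edist
      (facetPair _ 0 _ hA.isFacetFn) (facetPair _ 0 _ hk) ≤ 1) :
    ChangesOnce Ed A fun i => k (EuclideanSpace.single i 1) := by
  classical
  intro e he e' he' hAe hAe' hke hke'
  by_contra hne
  have h1 := finrank_le_card_of_edist_le_one 0 hA.isFacetFn hk h
  rw [finrank_span_zoneVectors hconn] at h1
  have h2 := card_filter_zoneVectors_le (Ed := Ed)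
    (fun v => cutFunctional A v = 0 ∧ k v = 0)
    (fun e => A e.1 = A e.2 ∧ k (EuclideanSpace.single e.1 1) = k (EuclideanSpace.single e.2 1))
    fun e _ h => h.imp cutFunctional_eq_zero_iff.1 fun h => by
      rwa [zoneVector, map_sub, sub_eq_zero] at h
  have h3 : insert e (insert e' (Ed.filter fun e => A e.1 = A e.2 ∧
      k (EuclideanSpace.single e.1 1) = k (EuclideanSpace.single e.2 1))) ⊆
      Ed.filter fun e => A e.1 = A e.2 := by
    intro x hx
    simp only [Finset.mem_insert, Finset.mem_filter] at hx ⊢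
    rcases hx with rfl | rfl | hx
    · exact ⟨he, hAe⟩
    · exact ⟨he', hAe'⟩
    · exact ⟨hx.1, hx.2.1⟩
  have h4 := Finset.card_le_card h3
  rw [Finset.card_insert_of_notMem, Finset.card_insert_of_notMem] at h4
  · omega
  · simp only [Finset.mem_filter, not_and]
    exact fun _ _ => hke'
  · simp only [Finset.mem_insert, Finset.mem_filter, not_or, not_and]
    exact ⟨hne, fun _ _ => hke⟩

/-- Two bonds are at distance at least three if no nonconstant function changes along at most one
edge off each of them. -/
theorem three_le_beltDiameter (hconn : IsConn Ed)
    (hA : IsBond Ed A) (hB : IsBond Ed B)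
    (hcardA : (Ed.filter fun e => A e.1 = A e.2).card + 1 ≤ n)
    (hcardB : (Ed.filter fun e => B e.1 = B e.2).card + 1 ≤ n)
    (h : ∀ f : Fin (n + 1) → ℝ, ChangesOnce Ed A f → ChangesOnce Ed B f → ∀ x y, f x = f y) :
    3 ≤ beltDiameter (zonotope (zoneVectors Ed)) := by
  rw [← zero_vadd (EuclideanSpace ℝ (Fin (n + 1))) (zonotope _)]
  by_contra hlt
  replace hlt := (ENat.lt_add_one_iff (by simp)).1
    ((not_le.1 hlt).trans_eq two_add_one_eq_three.symm)
  obtain ⟨r, h1, h2⟩ := exists_middle_of_edist_le_two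
    ((SimpleGraph.edist_le_ediam (u := facetPair _ 0 _ hA.isFacetFn)
      (v := facetPair _ 0 _ hB.isFacetFn)).trans hlt)
  obtain ⟨k, hk, rfl⟩ := exists_eq_facetPair 0 r
  rw [SimpleGraph.edist_comm] at h2
  have h3 := h _ (changesOnce_of_edist_le_one hconn hA hcardA hk h1)
    (changesOnce_of_edist_le_one hconn hB hcardB hk h2)
  refine hk.2.1 ?_
  ext ⟨v, hv⟩
  obtain ⟨e, -, rfl⟩ := mem_zoneVectors.1 hv
  have := h3 e.1 e.2
  change k (zoneVector e.1 e.2) = 0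
  rw [zoneVector, map_sub, this, sub_self]

end LowerBound

/-! ### Graphs on an initial segment of the natural numbers -/

section Examples

/-- The graph on `0, …, d` whose edges are the pairs `i, j` with `E i j`. -/
def natEdges (d : ℕ) (E : ℕ → ℕ → Bool) : Finset (Fin (d + 1) × Fin (d + 1)) :=
  Finset.univ.filter fun e => E e.1 e.2

lemma mem_natEdges {d : ℕ} {E : ℕ → ℕ → Bool} {e : Fin (d + 1) × Fin (d + 1)} :
    e ∈ natEdges d E ↔ E e.1 e.2 := by
  simp [natEdges]

lemma card_filter_natEdges_le {d : ℕ} {E : ℕ → ℕ → Bool} (p : ℕ → ℕ → Prop)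
    [∀ e : Fin (d + 1) × Fin (d + 1), Decidable (p e.1 e.2)] (T : Finset (ℕ × ℕ))
    (h : ∀ i j, i ≤ d → j ≤ d → E i j → p i j → (i, j) ∈ T) :
    ((natEdges d E).filter fun e => p e.1 e.2).card ≤ T.card := by
  refine Finset.card_le_card_of_injOn (fun e => ((e.1 : ℕ), (e.2 : ℕ))) (fun e he => ?_) ?_
  · obtain ⟨h1, h2⟩ := Finset.mem_filter.1 he
    exact h _ _ (by omega) (by omega) (mem_natEdges.1 h1) h2
  · rintro ⟨a, b⟩ - ⟨a', b'⟩ - h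
    simpa [Fin.ext_iff] using h

/-- The extension to `ℕ` of a function on `0, …, d`. -/
def natExt {d : ℕ} {R : Type*} (f : Fin (d + 1) → R) (k : ℕ) : R :=
  f (Fin.ofNat (d + 1) k)

lemma natExt_of_le {d : ℕ} {R : Type*} (f : Fin (d + 1) → R) {k : ℕ} (hk : k ≤ d) :
    natExt f k = f ⟨k, by omega⟩ := by
  rw [natExt]
  congr 1
  exact Fin.ext (Nat.mod_eq_of_lt (by omega))

lemma natExt_val {d : ℕ} {R : Type*} (f : Fin (d + 1) → R) (i : Fin (d + 1)) :
    natExt f i = f i :=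
  natExt_of_le f (by omega)

lemma natExt_eq {d : ℕ} {E : ℕ → ℕ → Bool} {A : ℕ → Bool} {f : Fin (d + 1) → ℝ}
    (hf : ∀ e ∈ natEdges d E, A e.1 = A e.2 → f e.1 = f e.2) {i j : ℕ} (hi : i ≤ d) (hj : j ≤ d)
    (hE : E i j) (hA : A i = A j) : natExt f i = natExt f j := by
  rw [natExt_of_le f hi, natExt_of_le f hj]
  exact hf (⟨i, by omega⟩, ⟨j, by omega⟩) (mem_natEdges.2 hE) hA

lemma isBond_natEdges {d : ℕ} {E : ℕ → ℕ → Bool} {A : ℕ → Bool} {i j : ℕ} (hi : i ≤ d)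
    (hj : j ≤ d) (hE : E i j) (hA : A i ≠ A j)
    (h : ∀ F : ℕ → ℝ, (∀ i j, i ≤ d → j ≤ d → E i j → A i = A j → F i = F j) →
      ∃ a b, ∀ k ≤ d, F k = if A k then a else b) :
    IsBond (natEdges d E) fun k => A k := by
  refine ⟨fun f hf => ?_, (⟨i, by omega⟩, ⟨j, by omega⟩), mem_natEdges.2 hE, hA⟩
  obtain ⟨a, b, hab⟩ := h (natExt f) fun i j hi hj hE hA => natExt_eq hf hi hj hE hA
  exact ⟨a, b, fun x => by rw [← natExt_val f x, hab x (by omega)]⟩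

lemma isConn_natEdges {d : ℕ} {E : ℕ → ℕ → Bool}
    (h : ∀ k, E k (k + 1)) : IsConn (natEdges d E) := by
  intro f hf
  have hstep : ∀ k ≤ d, natExt f k = natExt f 0 := by
    intro k
    induction k with
    | zero => simp
    | succ k ih =>
      intro hk
      rw [← ih (by omega)]
      exact (natExt_eq (A := fun _ => true) (fun e he _ => hf e he) (by omega) hk (h k) rfl).symm
  intro x y
  rw [← natExt_val f x, ← natExt_val f y, hstep x (by omega), hstep y (by omega)]

lemma eq_of_forall_step {F : ℕ → ℝ} {a b : ℕ} (h : ∀ k, a ≤ k → k < b → F k = F (k + 1)) {k : ℕ}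
    (hak : a ≤ k) (hkb : k ≤ b) : F k = F a := by
  induction k, hak using Nat.le_induction with
  | base => rfl
  | succ k hk ih => rw [← h k hk (by omega), ih (by omega)]

lemma exists_change {F : ℕ → ℝ} {a b : ℕ} (hab : a ≤ b) (h : F a ≠ F b) :
    ∃ k, a ≤ k ∧ k < b ∧ F k ≠ F (k + 1) := by
  by_contra! h'
  exact h (eq_of_forall_step h' hab le_rfl).symm

/-! ### The cycle, attaining belt diameter two -/

/-- The edges of the cycle on `0, …, d`. -/
def cycleEdge (d i j : ℕ) : Bool :=
  j == i + 1 || (i == 0 && j == d)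

lemma two_le_beltDiameter_cycle {d : ℕ} (hd : 3 ≤ d) :
    2 ≤ beltDiameter (zonotope (zoneVectors (natEdges d (cycleEdge d)))) := by
  refine two_le_beltDiameter (A := fun k => decide ((k : ℕ) ≤ 1))
    (B := fun k => decide ((k : ℕ) = 1 ∨ (k : ℕ) = 2))
    (isConn_natEdges fun k => by simp [cycleEdge])
    (isBond_natEdges (A := fun k => decide (k ≤ 1)) (i := 1) (j := 2) (by omega) (by omega)
      (by simp [cycleEdge]) (by simp) fun F hF => ?_)
    (isBond_natEdges (A := fun k => decide (k = 1 ∨ k = 2)) (i := 0) (j := 1) (by omega)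
      (by omega) (by simp [cycleEdge]) (by simp) fun F hF => ?_) ?_
  · have h01 : F 0 = F 1 := hF 0 1 (by omega) (by omega) (by simp [cycleEdge]) (by simp)
    refine ⟨F 0, F 2, fun k hk => ?_⟩
    by_cases h : k ≤ 1
    · simp only [h, decide_true, if_true]
      interval_cases k
      · rfl
      · exact h01.symm
    · simp only [h, decide_false]
      refine eq_of_forall_step (b := d) (fun k h1 h2 => hF k (k + 1) (by omega) (by omega)
        (by simp [cycleEdge]) ?_) (by omega) hk
      simp only [decide_eq_decide]
      omega
  · have h12 : F 1 = F 2 := hF 1 2 (by omega) (by omega) (by simp [cycleEdge]) (by simp)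
    have h0d : F 0 = F d := hF 0 d (by omega) (by omega) (by simp [cycleEdge]) (by
      simp only [decide_eq_decide]; omega)
    have h3 : ∀ k, 3 ≤ k → k ≤ d → F k = F 3 := fun k h1 h2 =>
      eq_of_forall_step (b := d) (fun k h1 h2 => hF k (k + 1) (by omega) (by omega)
        (by simp [cycleEdge]) (by simp only [decide_eq_decide]; omega)) h1 h2
    refine ⟨F 1, F 3, fun k hk => ?_⟩
    by_cases h : k = 1 ∨ k = 2
    · simp only [h, decide_true, if_true]
      rcases h with rfl | rfl
      · rfl
      · exact h12.symm
    · simp only [h, decide_false]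
      rcases Nat.eq_zero_or_pos k with rfl | hpos
      · rw [h0d]; exact h3 d hd le_rfl
      · exact h3 k (by omega) hk
  · have := card_filter_natEdges_le (d := d) (E := cycleEdge d)
      (fun i j => decide (i ≤ 1) = decide (j ≤ 1) ∧
        decide (i = 1 ∨ i = 2) = decide (j = 1 ∨ j = 2))
      ((Finset.Ico 3 d).image fun k => (k, k + 1)) (fun i j hi hj hE hp => by
        simp only [cycleEdge, Bool.or_eq_true, Bool.and_eq_true, beq_iff_eq, decide_eq_decide]
          at hE hp
        simp only [Finset.mem_image, Finset.mem_Ico, Prod.mk.injEq]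
        exact ⟨i, by omega, rfl, by omega⟩)
    have h2 : ((Finset.Ico 3 d).image fun k => (k, k + 1)).card ≤ d - 3 :=
      Finset.card_image_le.trans (by simp)
    omega

lemma lt_of_mem_cycle {d : ℕ} (hd : 3 ≤ d) : ∀ e ∈ natEdges d (cycleEdge d), e.1 < e.2 := by
  intro e he
  have := mem_natEdges.1 he
  simp only [cycleEdge, Bool.or_eq_true, Bool.and_eq_true, beq_iff_eq] at this
  rw [Fin.lt_def]
  omega

/-! ### The subdivided cubic graph, attaining belt diameter three -/

/-- The edges of a subdivision of a cubic graph with eight vertices: a Hamiltonian cycle through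
`0, …, d` with four chords. -/
def cubicEdge (d i j : ℕ) : Bool :=
  j == i + 1 || (i == 0 && j == d) || (i == 0 && j == 3) || (i == 1 && j == 6) ||
    (i == 2 && j == 5) || (i == 4 && j == 7)

lemma cubicEdge_iff {d i j : ℕ} : cubicEdge d i j ↔ j = i + 1 ∨ i = 0 ∧ j = d ∨ i = 0 ∧ j = 3 ∨
    i = 1 ∧ j = 6 ∨ i = 2 ∧ j = 5 ∨ i = 4 ∧ j = 7 := by
  simp only [cubicEdge, Bool.or_eq_true, Bool.and_eq_true, beq_iff_eq, or_assoc]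

lemma lt_of_mem_cubic {d : ℕ} (hd : 7 ≤ d) : ∀ e ∈ natEdges d (cubicEdge d), e.1 < e.2 := by
  intro e he
  have := cubicEdge_iff.1 (mem_natEdges.1 he)
  rw [Fin.lt_def]
  omega

/-- The first cut of the subdivided cubic graph. -/
def cubicCut₁ (k : ℕ) : Bool :=
  decide (k ≤ 2 ∨ k = 5 ∨ 8 ≤ k)

/-- The second cut of the subdivided cubic graph. -/
def cubicCut₂ (k : ℕ) : Bool :=
  decide (k = 0 ∨ k = 2 ∨ k = 3 ∨ 7 ≤ k)

lemma cubicCut₁_eq_iff {i j : ℕ} : cubicCut₁ i = cubicCut₁ j ↔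
    ((i ≤ 2 ∨ i = 5 ∨ 8 ≤ i) ↔ (j ≤ 2 ∨ j = 5 ∨ 8 ≤ j)) := by
  simp only [cubicCut₁, decide_eq_decide]

lemma cubicCut₂_eq_iff {i j : ℕ} : cubicCut₂ i = cubicCut₂ j ↔
    ((i = 0 ∨ i = 2 ∨ i = 3 ∨ 7 ≤ i) ↔ (j = 0 ∨ j = 2 ∨ j = 3 ∨ 7 ≤ j)) := by
  simp only [cubicCut₂, decide_eq_decide]

lemma isBond_cubicCut₁ {d : ℕ} (hd : 7 ≤ d) :
    IsBond (natEdges d (cubicEdge d)) fun k => cubicCut₁ k := by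
  refine isBond_natEdges (i := 2) (j := 3) (by omega) (by omega) (by simp [cubicEdge])
    (by simp [cubicCut₁]) fun F hF => ?_
  have hF' : ∀ i j, i ≤ d → j ≤ d → (j = i + 1 ∨ i = 0 ∧ j = d ∨ i = 0 ∧ j = 3 ∨
      i = 1 ∧ j = 6 ∨ i = 2 ∧ j = 5 ∨ i = 4 ∧ j = 7) →
      ((i ≤ 2 ∨ i = 5 ∨ 8 ≤ i) ↔ (j ≤ 2 ∨ j = 5 ∨ 8 ≤ j)) → F i = F j :=
    fun i j hi hj h1 h2 => hF i j hi hj (cubicEdge_iff.2 h1) (cubicCut₁_eq_iff.2 h2)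
  have h01 := hF' 0 1 (by omega) (by omega) (by omega) (by omega)
  have h12 := hF' 1 2 (by omega) (by omega) (by omega) (by omega)
  have h25 := hF' 2 5 (by omega) (by omega) (by omega) (by omega)
  have h34 := hF' 3 4 (by omega) (by omega) (by omega) (by omega)
  have h47 := hF' 4 7 (by omega) (by omega) (by omega) (by omega)
  have h67 := hF' 6 7 (by omega) (by omega) (by omega) (by omega)
  have h8 : ∀ k, 8 ≤ k → k ≤ d → F k = F 8 := fun k h1 h2 =>
    eq_of_forall_step (b := d) (fun k h1 h2 => hF' k (k + 1) (by omega) (by omega)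
      (by omega) (by omega)) h1 h2
  refine ⟨F 0, F 3, fun k hk => ?_⟩
  by_cases h : k ≤ 7
  · interval_cases k <;> simp [cubicCut₁] <;> linarith
  · have h0d := hF' 0 d (by omega) (by omega) (by omega) (by omega)
    have : cubicCut₁ k = true := by simp [cubicCut₁]; omega
    rw [if_pos this, h0d, h8 k (by omega) hk, h8 d (by omega) le_rfl]

lemma isBond_cubicCut₂ {d : ℕ} (hd : 7 ≤ d) :
    IsBond (natEdges d (cubicEdge d)) fun k => cubicCut₂ k := by
  refine isBond_natEdges (i := 0) (j := 1) (by omega) (by omega) (by simp [cubicEdge])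
    (by simp [cubicCut₂]) fun F hF => ?_
  have hF' : ∀ i j, i ≤ d → j ≤ d → (j = i + 1 ∨ i = 0 ∧ j = d ∨ i = 0 ∧ j = 3 ∨
      i = 1 ∧ j = 6 ∨ i = 2 ∧ j = 5 ∨ i = 4 ∧ j = 7) →
      ((i = 0 ∨ i = 2 ∨ i = 3 ∨ 7 ≤ i) ↔ (j = 0 ∨ j = 2 ∨ j = 3 ∨ 7 ≤ j)) → F i = F j :=
    fun i j hi hj h1 h2 => hF i j hi hj (cubicEdge_iff.2 h1) (cubicCut₂_eq_iff.2 h2)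
  have h03 := hF' 0 3 (by omega) (by omega) (by omega) (by omega)
  have h23 := hF' 2 3 (by omega) (by omega) (by omega) (by omega)
  have h16 := hF' 1 6 (by omega) (by omega) (by omega) (by omega)
  have h45 := hF' 4 5 (by omega) (by omega) (by omega) (by omega)
  have h56 := hF' 5 6 (by omega) (by omega) (by omega) (by omega)
  have h0d := hF' 0 d (by omega) (by omega) (by omega) (by omega)
  have h7 : ∀ k, 7 ≤ k → k ≤ d → F k = F 7 := fun k h1 h2 =>
    eq_of_forall_step (b := d) (fun k h1 h2 => hF' k (k + 1) (by omega) (by omega)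
      (by omega) (by omega)) h1 h2
  have h7d := h7 d hd le_rfl
  refine ⟨F 0, F 1, fun k hk => ?_⟩
  by_cases h : k ≤ 7
  · interval_cases k <;> simp [cubicCut₂] <;> linarith
  · have : cubicCut₂ k = true := by simp [cubicCut₂]; omega
    rw [if_pos this, h0d, h7 k (by omega) hk, h7d]

lemma card_cubicCut₁ {d : ℕ} (hd : 7 ≤ d) :
    ((natEdges d (cubicEdge d)).filter fun e => cubicCut₁ e.1 = cubicCut₁ e.2).card + 1 ≤ d := by
  -- For `d = 7` the edge `(0, d)` joins `0` to `7` and crosses the cut, so counting it as in the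
  -- general case would exceed the bound by one.
  rcases hd.eq_or_lt with rfl | hd'
  · have h1 := card_filter_natEdges_le (d := 7) (E := cubicEdge 7)
      (fun i j => cubicCut₁ i = cubicCut₁ j)
      {(0, 1), (1, 2), (2, 5), (3, 4), (6, 7), (4, 7)} (fun i j hi hj hE hp => by
        rw [cubicEdge_iff] at hE
        rw [cubicCut₁_eq_iff] at hp
        simp only [Finset.mem_insert, Finset.mem_singleton, Prod.mk.injEq]
        rcases hE with rfl | ⟨rfl, rfl⟩ | ⟨rfl, rfl⟩ | ⟨rfl, rfl⟩ | ⟨rfl, rfl⟩ | ⟨rfl, rfl⟩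
        · have h' : i ≤ 6 := by omega
          interval_cases i <;> simp at hp ⊢
        all_goals simp at hp ⊢)
    exact Nat.succ_le_succ (h1.trans Finset.card_le_six)
  have h1 := card_filter_natEdges_le (d := d) (E := cubicEdge d)
    (fun i j => cubicCut₁ i = cubicCut₁ j)
    ({(0, 1), (1, 2), (2, 5), (3, 4), (6, 7), (4, 7), (0, d)} ∪
      (Finset.Ico 8 d).image fun k => (k, k + 1)) (fun i j hi hj hE hp => by
        rw [cubicEdge_iff] at hE
        rw [cubicCut₁_eq_iff] at hp
        simp only [Finset.mem_union, Finset.mem_insert, Finset.mem_singleton, Finset.mem_image,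
          Finset.mem_Ico, Prod.mk.injEq]
        by_cases h : 8 ≤ i
        · exact Or.inr ⟨i, by omega, rfl, by omega⟩
        · have h' : i ≤ 7 := by omega
          rcases hE with rfl | ⟨rfl, rfl⟩ | ⟨rfl, rfl⟩ | ⟨rfl, rfl⟩ | ⟨rfl, rfl⟩ | ⟨rfl, rfl⟩
          · left; interval_cases i <;> simp at hp ⊢
          all_goals first | (simp; done) | simp at hp)
  have h2 := Finset.card_union_le ({(0, 1), (1, 2), (2, 5), (3, 4), (6, 7), (4, 7), (0, d)} :
    Finset (ℕ × ℕ)) ((Finset.Ico 8 d).image fun k => (k, k + 1))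
  have h3 : ((Finset.Ico 8 d).image fun k => (k, k + 1)).card ≤ d - 8 :=
    Finset.card_image_le.trans (by simp)
  have h4 : ({(0, 1), (1, 2), (2, 5), (3, 4), (6, 7), (4, 7), (0, d)} :
    Finset (ℕ × ℕ)).card ≤ 7 := 
    (Finset.card_insert_le _ _).trans (Nat.succ_le_succ Finset.card_le_six)
  omega

lemma card_cubicCut₂ {d : ℕ} (hd : 7 ≤ d) :
    ((natEdges d (cubicEdge d)).filter fun e => cubicCut₂ e.1 = cubicCut₂ e.2).card + 1 ≤ d := by
  have h1 := card_filter_natEdges_le (d := d) (E := cubicEdge d)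
    (fun i j => cubicCut₂ i = cubicCut₂ j)
    ({(0, 3), (2, 3), (1, 6), (4, 5), (5, 6), (0, d)} ∪
      (Finset.Ico 7 d).image fun k => (k, k + 1)) (fun i j hi hj hE hp => by
        rw [cubicEdge_iff] at hE
        rw [cubicCut₂_eq_iff] at hp
        simp only [Finset.mem_union, Finset.mem_insert, Finset.mem_singleton, Finset.mem_image,
          Finset.mem_Ico, Prod.mk.injEq]
        by_cases h : 7 ≤ i
        · exact Or.inr ⟨i, by omega, rfl, by omega⟩
        · have h' : i ≤ 6 := by omega
          rcases hE with rfl | ⟨rfl, rfl⟩ | ⟨rfl, rfl⟩ | ⟨rfl, rfl⟩ | ⟨rfl, rfl⟩ | ⟨rfl, rfl⟩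
          · left; interval_cases i <;> simp at hp ⊢
          all_goals first | (simp; done) | simp at hp)
  have h2 := Finset.card_union_le ({(0, 3), (2, 3), (1, 6), (4, 5), (5, 6), (0, d)} :
    Finset (ℕ × ℕ)) ((Finset.Ico 7 d).image fun k => (k, k + 1))
  have h3 : ((Finset.Ico 7 d).image fun k => (k, k + 1)).card ≤ d - 7 :=
    Finset.card_image_le.trans (by simp)
  have h4 : ({(0, 3), (2, 3), (1, 6), (4, 5), (5, 6), (0, d)} :
    Finset (ℕ × ℕ)).card ≤ 6 := Finset.card_le_six
  omega

/-- A two-colouring of the cubic graph with at most one bichromatic edge off each of the two cuts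
is constant. -/
lemma cubic_colouring_constant : ∀ b₀ b₁ b₂ b₃ b₄ b₅ b₆ b₇ : Bool,
    [(b₀, b₁), (b₁, b₂), (b₂, b₅), (b₃, b₄), (b₆, b₇), (b₄, b₇)].Pairwise
      (fun p q => p.1 = p.2 ∨ q.1 = q.2) →
    [(b₀, b₃), (b₂, b₃), (b₁, b₆), (b₄, b₅), (b₅, b₆), (b₀, b₇)].Pairwise
      (fun p q => p.1 = p.2 ∨ q.1 = q.2) →
    b₁ = b₀ ∧ b₂ = b₀ ∧ b₃ = b₀ ∧ b₄ = b₀ ∧ b₅ = b₀ ∧ b₆ = b₀ ∧ b₇ = b₀ := by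
  intros
  simp only [List.pairwise_cons, List.mem_cons, List.not_mem_nil, or_false, forall_eq_or_imp,
    forall_eq] at *
  grind

/-- A two-colouring of the nine vertices with at most one bichromatic edge off each of the two cuts
is constant. -/
lemma example_colouring_constant : ∀ b₀ b₁ b₂ b₃ b₄ b₅ b₆ b₇ b₈ : Bool,
    [(b₀, b₁), (b₁, b₂), (b₂, b₃), (b₃, b₄), (b₅, b₈), (b₇, b₈), (b₆, b₇)].Pairwise
      (fun p q => p.1 = p.2 ∨ q.1 = q.2) →
    [(b₀, b₁), (b₂, b₅), (b₄, b₅), (b₄, b₇), (b₃, b₆), (b₁, b₆), (b₀, b₈)].Pairwise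
      (fun p q => p.1 = p.2 ∨ q.1 = q.2) →
    b₁ = b₀ ∧ b₂ = b₀ ∧ b₃ = b₀ ∧ b₄ = b₀ ∧ b₅ = b₀ ∧ b₆ = b₀ ∧ b₇ = b₀ ∧ b₈ = b₀ := by
  intros
  simp only [List.pairwise_cons, List.mem_cons, List.not_mem_nil, or_false, forall_eq_or_imp,
    forall_eq] at *
  grind

/-- Colouring vertices by whether `f` takes the value `c` reduces real functions to two-colourings:
an edge with two colours is one along which `f` changes. -/
lemma pairwise_map_of_forall {α : Type*} {f : α → ℝ} {L : List (α × α)} (hL : L.Nodup)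
    (h : ∀ p ∈ L, ∀ q ∈ L, f p.1 ≠ f p.2 → f q.1 ≠ f q.2 → p = q) (c : ℝ) :
    (L.map fun p => (decide (f p.1 = c), decide (f p.2 = c))).Pairwise
      fun p q => p.1 = p.2 ∨ q.1 = q.2 := by
  rw [List.pairwise_map]
  refine List.Pairwise.imp_of_mem (fun {p q} hp hq hne => ?_) hL
  by_contra! hc
  refine hne (h p hp q hq (fun h' => hc.1 ?_) fun h' => hc.2 ?_)
  · simp only [h']
  · simp only [h']

lemma ChangesOnce.natExt {d : ℕ} {E : ℕ → ℕ → Bool} {A : ℕ → Bool} {f : Fin (d + 1) → ℝ}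
    (h : ChangesOnce (natEdges d E) (fun k => A k) f) {i j i' j' : ℕ} (hi : i ≤ d) (hj : j ≤ d)
    (hi' : i' ≤ d) (hj' : j' ≤ d) (hE : E i j) (hE' : E i' j') (hA : A i = A j)
    (hA' : A i' = A j') (hf : natExt f i ≠ natExt f j) (hf' : natExt f i' ≠ natExt f j') :
    i = i' ∧ j = j' := by
  rw [natExt_of_le f hi, natExt_of_le f hj] at hf
  rw [natExt_of_le f hi', natExt_of_le f hj'] at hf'
  have := h (⟨i, by omega⟩, ⟨j, by omega⟩) (mem_natEdges.2 hE) (⟨i', by omega⟩, ⟨j', by omega⟩)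
    (mem_natEdges.2 hE') hA hA' hf hf'
  simpa using this

lemma eq_of_changesOnce_cubic {d : ℕ} (hd : 7 ≤ d) {f : Fin (d + 1) → ℝ}
    (hA : ChangesOnce (natEdges d (cubicEdge d)) (fun k => cubicCut₁ k) f)
    (hB : ChangesOnce (natEdges d (cubicEdge d)) (fun k => cubicCut₂ k) f) (x y : Fin (d + 1)) :
    f x = f y := by
  set F := natExt f with hF
  have hstep : ∀ k, cubicEdge d k (k + 1) := fun k => cubicEdge_iff.2 (Or.inl rfl)
  have h0d : cubicEdge d 0 d := cubicEdge_iff.2 (Or.inr (Or.inl ⟨rfl, rfl⟩))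
  have hcut : ∀ i j, (i = 0 ∨ 7 ≤ i) → 7 ≤ j → cubicCut₂ i = cubicCut₂ j := fun i j hi hj =>
    cubicCut₂_eq_iff.2 (by omega)
  have h1 := pairwise_map_of_forall (f := F)
    (L := [(0, 1), (1, 2), (2, 5), (3, 4), (6, 7), (4, 7)]) (by decide) (fun p hp q hq hFp hFq => by
      have hL : ∀ p ∈ [(0, 1), (1, 2), (2, 5), (3, 4), (6, 7), (4, 7)],
          p.1 ≤ d ∧ p.2 ≤ d ∧ cubicEdge d p.1 p.2 ∧ cubicCut₁ p.1 = cubicCut₁ p.2 := by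
        simp [cubicEdge, cubicCut₁]
        omega
      obtain ⟨h1, h2, h3, h4⟩ := hL p hp
      obtain ⟨h1', h2', h3', h4'⟩ := hL q hq
      exact Prod.ext_iff.2 (hA.natExt h1 h2 h1' h2' h3 h3' h4 h4' hFp hFq)) (F 0)
  have h2 := pairwise_map_of_forall (f := F)
    (L := [(0, 3), (2, 3), (1, 6), (4, 5), (5, 6), (0, 7)]) (by decide) (fun p hp q hq hFp hFq => by
      have hL : ∀ p ∈ [(0, 3), (2, 3), (1, 6), (4, 5), (5, 6), (0, 7)], F p.1 ≠ F p.2 →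
          p.2 ≤ 7 ∧ (p.2 = 7 → p.1 = 0) ∧ ∃ i j, i ≤ d ∧ j ≤ d ∧ cubicEdge d i j ∧
            cubicCut₂ i = cubicCut₂ j ∧ F i ≠ F j ∧ (i = p.1 ∧ j = p.2 ∨
            p.1 = 0 ∧ p.2 = 7 ∧ 7 ≤ j) := by
        intro p hp hFp
        -- The edge `07` of the cubic graph stands for the path `7, 8, …, d, 0`, which does not
        -- cross the second cut. If the values at its ends differ, some edge of the path carries a
        -- change.
        by_cases hp7 : p = (0, 7)
        · subst hp7
          refine ⟨le_rfl, fun _ => rfl, ?_⟩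
          by_cases hFd : F 0 = F d
          · obtain ⟨k, hk1, hk2, hk3⟩ := exists_change hd (fun h' => hFp (hFd.trans h'.symm))
            exact ⟨k, k + 1, by omega, by omega, hstep k, hcut _ _ (by omega) (by omega), hk3,
              Or.inr ⟨rfl, rfl, by omega⟩⟩
          · exact ⟨0, d, by omega, le_rfl, h0d, hcut _ _ (by omega) hd, hFd,
              Or.inr ⟨rfl, rfl, hd⟩⟩
        · have hp' : p ∈ [(0, 3), (2, 3), (1, 6), (4, 5), (5, 6)] := by
            simp only [List.mem_cons, List.not_mem_nil, or_false] at hp ⊢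
            tauto
          have : p.2 ≤ 6 ∧ p.1 ≤ d ∧ p.2 ≤ d ∧ cubicEdge d p.1 p.2 ∧
              cubicCut₂ p.1 = cubicCut₂ p.2 := by
            revert p
            simp [cubicEdge, cubicCut₂]
            omega
          exact ⟨by omega, by omega, p.1, p.2, this.2.1, this.2.2.1, this.2.2.2.1, this.2.2.2.2,
            hFp, Or.inl ⟨rfl, rfl⟩⟩
      obtain ⟨hp7, hp0, i, j, h1, h2, h3, h4, h5, h6⟩ := hL p hp hFp
      obtain ⟨hq7, hq0, i', j', h1', h2', h3', h4', h5', h6'⟩ := hL q hq hFq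
      have := hB.natExt h1 h2 h1' h2' h3 h3' h4 h4' h5 h5'
      refine Prod.ext ?_ ?_ <;> omega) (F 0)
  have h3 := cubic_colouring_constant _ _ _ _ _ _ _ _ h1 h2
  simp only [decide_eq_decide, iff_true] at h3
  have hsmall : ∀ k ≤ 7, F k = F 0 := by
    intro k hk
    interval_cases k
    · rfl
    all_goals tauto
  have hall : ∀ k ≤ d, F k = F 0 := by
    intro k hk
    by_contra hne
    have hk7 : 7 < k := by
      by_contra h'
      exact hne (hsmall k (by omega))
    -- A value different from `F 0` inside the subdivided path forces a change both before and after
    -- `k`, hence two changes off the second cut.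
    obtain ⟨k₁, h1, h2, h3⟩ := exists_change hk7.le
      (show F 7 ≠ F k by rw [hsmall 7 le_rfl]; exact Ne.symm hne)
    by_cases hFd : F 0 = F d
    · obtain ⟨k₂, h1', h2', h3'⟩ := exists_change hk (show F k ≠ F d by rw [← hFd]; exact hne)
      have := hB.natExt (i := k₁) (j := k₁ + 1) (i' := k₂) (j' := k₂ + 1) (by omega) (by omega)
        (by omega) (by omega) (hstep _) (hstep _) (hcut _ _ (by omega) (by omega))
        (hcut _ _ (by omega) (by omega)) h3 h3'
      omega
    · have := hB.natExt (i := k₁) (j := k₁ + 1) (i' := 0) (j' := d) (by omega) (by omega)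
        (by omega) le_rfl (hstep _) h0d (hcut _ _ (by omega) (by omega))
        (hcut _ _ (by omega) (by omega)) h3 hFd
      omega
  rw [← natExt_val f x, ← natExt_val f y, ← hF, hall x (by omega), hall y (by omega)]

lemma isConn_cubic (d : ℕ) : IsConn (natEdges d (cubicEdge d)) :=
  isConn_natEdges fun _ => cubicEdge_iff.2 (Or.inl rfl)

lemma three_le_beltDiameter_cubic {d : ℕ} (hd : 7 ≤ d) :
    3 ≤ beltDiameter (zonotope (zoneVectors (natEdges d (cubicEdge d)))) :=
  three_le_beltDiameter (isConn_cubic d) (isBond_cubicCut₁ hd) (isBond_cubicCut₂ hd)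
    (card_cubicCut₁ hd) (card_cubicCut₂ hd) fun _ hA hB => eq_of_changesOnce_cubic hd hA hB

/-! ### The non-symmetric example in dimension eight -/

lemma lt_of_mem_exampleEdges : ∀ e ∈ exampleEdges, e.1 < e.2 := by
  decide

/-- The first cut of the example, with the side `A₁, …, A₅`. -/
def exampleCut₁ (k : Fin 9) : Bool :=
  decide (k ≤ 4)

/-- The second cut of the example. -/
def exampleCut₂ (k : Fin 9) : Bool :=
  decide (k ∈ ({0, 1, 3, 6, 8} : Finset (Fin 9)))

lemma isBond_exampleCut₁ : IsBond (n := 8) exampleEdges exampleCut₁ := by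
  refine ⟨fun f hf => ⟨f 0, f 5, fun x => ?_⟩, (2, 5), by decide, by decide⟩
  have h01 : f 0 = f 1 := hf (0, 1) (by decide) (by decide)
  have h12 : f 1 = f 2 := hf (1, 2) (by decide) (by decide)
  have h23 : f 2 = f 3 := hf (2, 3) (by decide) (by decide)
  have h34 : f 3 = f 4 := hf (3, 4) (by decide) (by decide)
  have h58 : f 5 = f 8 := hf (5, 8) (by decide) (by decide)
  have h78 : f 7 = f 8 := hf (7, 8) (by decide) (by decide)
  have h67 : f 6 = f 7 := hf (6, 7) (by decide) (by decide)
  fin_cases x <;> simp [exampleCut₁] <;> linarith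

lemma isBond_exampleCut₂ : IsBond (n := 8) exampleEdges exampleCut₂ := by
  refine ⟨fun f hf => ⟨f 0, f 2, fun x => ?_⟩, (1, 2), by decide, by decide⟩
  have h01 : f 0 = f 1 := hf (0, 1) (by decide) (by decide)
  have h16 : f 1 = f 6 := hf (1, 6) (by decide) (by decide)
  have h36 : f 3 = f 6 := hf (3, 6) (by decide) (by decide)
  have h08 : f 0 = f 8 := hf (0, 8) (by decide) (by decide)
  have h25 : f 2 = f 5 := hf (2, 5) (by decide) (by decide)
  have h45 : f 4 = f 5 := hf (4, 5) (by decide) (by decide)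
  have h47 : f 4 = f 7 := hf (4, 7) (by decide) (by decide)
  fin_cases x <;> simp [exampleCut₂] <;> linarith

lemma isConn_example : IsConn (n := 8) exampleEdges := by
  intro f hf x y
  obtain ⟨a, b, hab⟩ := isBond_exampleCut₁.exists_const f fun e he _ => hf e he
  have h25 : f 2 = f 5 := hf (2, 5) (by decide)
  rw [hab 2, hab 5] at h25
  have : a = b := by simpa [exampleCut₁] using h25
  rw [hab x, hab y, this, ite_self, ite_self]

lemma ChangesOnce.pairwise {n : ℕ} {Ed : Finset (Fin (n + 1) × Fin (n + 1))}
    {A : Fin (n + 1) → Bool} {f : Fin (n + 1) → ℝ} (h : ChangesOnce Ed A f)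
    {L : List (Fin (n + 1) × Fin (n + 1))} (hL : L.Nodup)
    (hLE : ∀ p ∈ L, p ∈ Ed ∧ A p.1 = A p.2) (c : ℝ) :
    (L.map fun p => (decide (f p.1 = c), decide (f p.2 = c))).Pairwise
      fun p q => p.1 = p.2 ∨ q.1 = q.2 :=
  pairwise_map_of_forall hL (fun p hp q hq =>
    h p (hLE p hp).1 q (hLE q hq).1 (hLE p hp).2 (hLE q hq).2) c

lemma three_le_beltDiameter_example :
    3 ≤ beltDiameter (zonotope (zoneVectors (n := 8) exampleEdges)) := by
  refine three_le_beltDiameter isConn_example isBond_exampleCut₁ isBond_exampleCut₂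
    (by decide) (by decide) fun f hA hB => ?_
  have h1 := hA.pairwise (L := [(0, 1), (1, 2), (2, 3), (3, 4), (5, 8), (7, 8), (6, 7)])
    (by decide) (by decide) (f 0)
  have h2 := hB.pairwise (L := [(0, 1), (2, 5), (4, 5), (4, 7), (3, 6), (1, 6), (0, 8)])
    (by decide) (by decide) (f 0)
  have h3 := example_colouring_constant _ _ _ _ _ _ _ _ _ h1 h2
  simp only [decide_eq_decide, iff_true] at h3
  have h : ∀ x, f x = f 0 := by
    intro x
    fin_cases x
    · rfl
    all_goals simp; tauto
  intro x y
  rw [h x, h y]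

/-- Adding a common vector to `V₂` would not raise its rank from `d - 1` to `d`. -/
lemma IsConjugate.disjoint {E : Type*} [NormedAddCommGroup E] [NormedSpace ℝ E] {d : ℕ}
    {V₁ V₂ : Finset E}
    (h : IsConjugate d V₁ V₂) : Disjoint V₁ V₂ := by
  obtain ⟨-, -, -, -, h2, h3⟩ := h
  rw [Finset.disjoint_left]
  intro v hv1 hv2
  have := (h3 v hv1 v hv2).1
  rw [Set.insert_eq_of_mem (Finset.mem_coe.2 hv2)] at this
  omega

/-- Two disjoint conjugate sets have `7 + 7 = 14` vectors in total, but there are at most thirteen.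
-/
lemma not_isSymmetricZoneSet_example :
    ¬ IsSymmetricZoneSet 8 (zoneVectors (n := 8) exampleEdges) := by
  classical
  rintro ⟨V₁, V₂, h, hV⟩
  have h1 := h.1
  have h2 := h.2.1
  have hdisj := h.disjoint
  rw [← Finset.coe_union, Finset.coe_inj] at hV
  have h3 : (zoneVectors (n := 8) exampleEdges).card ≤ 13 :=
    Finset.card_image_le.trans (by decide)
  rw [hV, Finset.card_union_of_disjoint hdisj] at h3
  omega

end Examples

end PiZonotope

end

theorem mainTheorem1 :
    -- upper bounds
    (∀ (d n : ℕ) (P : Set (EuclideanSpace ℝ (Fin (n + 1)))), 3 ≤ d → d ≤ 6 →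
      PiZonotope.IsPiZonotope n P → PiZonotope.dim P = d → PiZonotope.beltDiameter P ≤ 2) ∧
    (∀ (d n : ℕ) (P : Set (EuclideanSpace ℝ (Fin (n + 1)))), 7 ≤ d →
      PiZonotope.IsPiZonotope n P → PiZonotope.dim P = d → PiZonotope.beltDiameter P ≤ 3) ∧
    -- both bounds are attained in every dimension
    (∀ d : ℕ, 3 ≤ d → d ≤ 6 → ∃ P : Set (EuclideanSpace ℝ (Fin (d + 1))),
      PiZonotope.IsPiZonotope d P ∧ PiZonotope.dim P = d ∧ PiZonotope.beltDiameter P = 2) ∧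
    (∀ d : ℕ, 7 ≤ d → ∃ P : Set (EuclideanSpace ℝ (Fin (d + 1))),
      PiZonotope.IsPiZonotope d P ∧ PiZonotope.dim P = d ∧ PiZonotope.beltDiameter P = 3) ∧
    -- the explicit non-symmetric example in dimension eight
    (PiZonotope.IsPiZonotope 8 (PiZonotope.zonotope PiZonotope.exampleZoneVectors) ∧
      PiZonotope.dim (PiZonotope.zonotope PiZonotope.exampleZoneVectors) = 8 ∧
      ¬ PiZonotope.IsSymmetricZoneSet 8 PiZonotope.exampleZoneVectors ∧
      PiZonotope.beltDiameter (PiZonotope.zonotope PiZonotope.exampleZoneVectors) = 3) := by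
  open PiZonotope in
  refine ⟨fun d n P _ hd hP hdim => (beltDiameter_le hP).2 (hdim ▸ hd),
    fun d n P _ hP _ => (beltDiameter_le hP).1, fun d hd hd' => ?_, fun d hd => ?_, ?_⟩
  · have hP := isPiZonotope_zoneVectors (lt_of_mem_cycle hd)
    have hdim := dim_zonotope_zoneVectors (isConn_natEdges (d := d) (E := cycleEdge d)
      fun k => by simp [cycleEdge])
    exact ⟨_, hP, hdim, le_antisymm ((beltDiameter_le hP).2 (hdim.trans_le hd'))
      (two_le_beltDiameter_cycle hd)⟩
  · have hP := isPiZonotope_zoneVectors (lt_of_mem_cubic hd)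
    exact ⟨_, hP, dim_zonotope_zoneVectors (isConn_cubic d),
      le_antisymm (beltDiameter_le hP).1 (three_le_beltDiameter_cubic hd)⟩
  · have hP := isPiZonotope_zoneVectors lt_of_mem_exampleEdges
    exact ⟨hP, dim_zonotope_zoneVectors isConn_example, not_isSymmetricZoneSet_example,
      le_antisymm (beltDiameter_le hP).1 three_le_beltDiameter_example⟩
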